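/- **Setting.** Let $k$ be a field of characteristic zero, $n\ge 3$, $k[\mathbf x]=k[x_1,\dots,x_n]$, let $\Gamma$ be a finitely generated totally ordered abelian group, and let $\mathbf w=(w_1,\dots,w_n)\in\Gamma^n$ with $w_i>0$ for all $i$. For $f\in k[\mathbf x]\setminus\{0\}$ let $\deg f\in\Gamma$ be its $\mathbf w$-weighted degree (the monomial $x_1^{a_1}\cdots x_n^{a_n}$ has degree $\sum a_iw_i$) and let $f^{\mathbf w}$ be its homogeneous component of degree $\deg f$; put $\deg 0=-\infty$. For a tuple, $\deg(f_1,\dots,f_l)=\sum_i\deg f_i$. For a differential form $\omega=\sum_{i_1<\dots<i_l}f_{i_1,\dots,i_l}\,dx_{i_1}\wedge\dots\wedge dx_{i_l}\in\bigwedge^l\Omega_{k[\mathbf x]/k}$ put $\deg\omega=\max_{i_1<\dots<i_l}\deg(f_{i_1,\dots,i_l}x_{i_1}\cdots x_{i_l})$. For nonzero $h_1,h_2\in k[\mathbf x]$ write $h_1\approx h_2$ if they are linearly dependent over $k$. Equalities and inequalities involving fractional multiples of elements of $\Gamma$ are understood in $\mathbf Q\otimes_{\mathbf Z}\Gamma$.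 Let $\mathcal T$ be the set of triples of elements of $k[\mathbf x]$ that are algebraically independent over $k$. A pair $(F,G)$ with $F=(f_1,f_2,f_3)$ and $G=(g_1,g_2,g_3)$ in $\mathcal T$ satisfies the *quasi Shestakov–Umirbaev condition* if * $g_1-f_1\in k[f_2,f_3]$, $g_2-f_2\in k[f_3]$ and $g_3-f_3\in k[g_1,g_2]$; * $\deg f_i\le\deg g_i$ for $i=1,2$; * $\deg g_2<\deg g_1$ and $g_1^{\mathbf w}\notin k[g_2^{\mathbf w}]$; * $\deg f_3\le\deg g_1$ and $f_3^{\mathbf w}\notin k[g_1^{\mathbf w},g_2^{\mathbf w}]$; * $\deg g_3<\deg f_3$; * $\deg g_3<\deg g_1-\deg g_2+\deg dg_1\wedge dg_2$. **Theorem.** Let $F=(f_1,f_2,f_3)$, $G=(g_1,g_2,g_3)\in\mathcal T$ be such that $(F,G)$ satisfies the quasi Shestakov–Umirbaev condition. Put $S_i=\{f_1,f_2,f_3\}\setminus\{f_i\}$. Then the following hold. * **(P1)** $(g_1^{\mathbf w})^2\approx(g_2^{\mathbf w})^s$ for some odd number $s\ge3$, and $\delta:=\tfrac12\deg g_2$ belongs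 to $\Gamma$. * **(P2)** $\deg f_3\ge(s-2)\delta+\deg dg_1\wedge dg_2$. * **(P3)** $\deg f_2=\deg g_2$. * **(P4)** If $\phi\in k[S_1]$ and $\deg\phi\le\deg g_1$, then there exist $a',c'\in k$ and $\psi'\in k[f_2]$ with $\deg\psi'\le(s-1)\delta$ such that $\phi=a'f_3^2+c'f_3+\psi'$. * **(P5)** If $\deg f_1<\deg g_1$, then $s=3$, $g_1^{\mathbf w}\approx(f_3^{\mathbf w})^2$, $\deg f_3=\tfrac32\delta$ and $\deg f_1\ge\tfrac52\delta+\deg dg_1\wedge dg_2$. * **(P6)** $\deg G<\deg F$. * **(P7)** $\deg f_2<\deg f_1$, $\deg f_3\le\deg f_1$, and $\delta<\deg f_i\le s\delta$ for $i=1,2,3$. * **(P8)** $f_i^{\mathbf w}\notin k[f_j^{\mathbf w}]$ if $i\ne j$ and $(i,j)\ne(1,3)$. If $f_1^{\mathbf w}\in k[f_3^{\mathbf w}]$, then $s=3$, $f_1^{\mathbf w}\approx(f_3^{\mathbf w})^2$ and $\deg f_3=\tfrac32\delta$. * **(P9)** If $\phi\in k[S_2]$ and $\deg\phi\le\deg f_2$,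 then there exist $b',d'\in k$ such that $\phi=b'f_3+d'$. * **(P10)** Assume $k[g_1,g_2]\ne k[S_3]$. If $\phi\in k[S_3]$ and $\deg\phi\le\deg f_1$, then there exist $c''\in k$ and $\psi''\in k[f_2]$ with $\deg\psi''\le\min\{(s-1)\delta,\deg\phi\}$ such that $\phi=c''f_1+\psi''$; if moreover $\deg\phi<\deg f_1$, then $c''=0$. * **(P11)** There exist $a,b,c,d\in k$ and $\psi\in k[f_2]$ with $\deg\psi\le(s-1)\delta$ such that $g_1=f_1+af_3^2+cf_3+\psi$ and $g_2=f_2+bf_3+d$. If $a\ne0$ or $b\ne0$, then $\deg f_3\le\deg f_2$. If $\deg f_3\le\deg f_2$, then $s=3$. Furthermore, if $\psi\in k$, then $a,b,c$ are uniquely determined by $F$ in the following sense: if $(F,G')$ satisfies the quasi Shestakov–Umirbaev condition for some $G'=(g_1',g_2',g_3')\in\mathcal T$ with $g_1'=f_1+a'f_3^2+c'f_3+\psi'$ and $g_2'=f_2+b'f_3+d'$, where $a',b',c',d',\psi'\in k$, then $a'=a$, $b'=b$ and $c'=c$. * **(P12)** With $a,b,c$ as in (P11), $$\deg df_1\wedge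 df_2=\begin{cases}\deg f_3+\deg df_2\wedge df_3&\text{if }a\ne0,\\ \deg df_1\wedge df_3&\text{if }a=0,\ b\ne0,\\ \deg df_2\wedge df_3&\text{if }a=b=0,\ c\ne0,\\ \deg dg_1\wedge dg_2&\text{if }a=b=c=0,\end{cases}$$ $$\deg df_1\wedge df_3=(s-2)\delta+\deg df_2\wedge df_3,\qquad \deg df_2\wedge df_3\ge s\delta+\deg dg_1\wedge dg_2.$$ -/

import Mathlib

open MvPolynomial
open scoped KaehlerDifferential

namespace ShestakovUmirbaev

section Defs

variable {k : Type*} [Field k] {Γ : Type*} [AddCommGroup Γ] [LinearOrder Γ] {n : ℕ}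

/-- The `w`-degree of a polynomial, with `deg 0 = ⊥` (playing the role of `-∞`). -/
noncomputable def wdeg (w : Fin n → Γ) (f : MvPolynomial (Fin n) k) : WithBot Γ :=
  weightedTotalDegree' w f

/-- The leading form `f ^ w`: the `w`-homogeneous component of `f` of degree `deg f`
(and `0` if `f = 0`). -/
noncomputable def lead (w : Fin n → Γ) (f : MvPolynomial (Fin n) k) : MvPolynomial (Fin n) k :=
  WithBot.recBotCoe 0 (fun γ => weightedHomogeneousComponent w γ f) (wdeg w f)

/-- The `w`-degree of a tuple: the sum of the `w`-degrees of its entries. -/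
noncomputable def tupleDeg (w : Fin n → Γ) {l : ℕ} (F : Fin l → MvPolynomial (Fin n) k) :
    WithBot Γ :=
  ∑ i, wdeg w (F i)

/-- The `w`-degree of a differential form
`ω = ∑ f_{i₁,…,i_l} dx_{i₁} ∧ ⋯ ∧ dx_{i_l}` (sum over `i₁ < ⋯ < i_l`): the maximum of the
`w`-degrees of the polynomials `f_{i₁,…,i_l} x_{i₁} ⋯ x_{i_l}`. -/
noncomputable def formDeg (w : Fin n → Γ) {l : ℕ}
    (ω : ⋀[MvPolynomial (Fin n) k]^l (Ω[MvPolynomial (Fin n) k⁄k])) : WithBot Γ :=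
  (Finset.univ : Finset (Set.powersetCard (Fin n) l)).sup fun s =>
    wdeg w (((KaehlerDifferential.mvPolynomialBasis k (Fin n)).exteriorPower l).repr ω s *
      ∏ i ∈ s.1, X i)

/-- The differential 2-form `df ∧ dg`. -/
noncomputable def dWedge (f g : MvPolynomial (Fin n) k) :
    ⋀[MvPolynomial (Fin n) k]^2 (Ω[MvPolynomial (Fin n) k⁄k]) :=
  exteriorPower.ιMulti (MvPolynomial (Fin n) k) 2
    ![KaehlerDifferential.D k (MvPolynomial (Fin n) k) f,
      KaehlerDifferential.D k (MvPolynomial (Fin n) k) g]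

/-- `h₁ ≈ h₂`: the polynomials `h₁` and `h₂` are linearly dependent over `k`
(only used for nonzero `h₁`, `h₂`). -/
def Approx (h₁ h₂ : MvPolynomial (Fin n) k) : Prop :=
  ¬ LinearIndependent k ![h₁, h₂]

/-- The quasi Shestakov-Umirbaev condition for a pair of triples `F = (f₁, f₂, f₃)` and
`G = (g₁, g₂, g₃)`; the entry `fᵢ` is `F (i - 1)`. All degrees occurring in `su6` are finite when
`F` and `G` are algebraically independent, and `su6` is the inequality
`deg g₃ < deg g₁ - deg g₂ + deg (dg₁ ∧ dg₂)` with `deg g₂` moved to the left. -/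
structure QuasiSU (w : Fin n → Γ) (F G : Fin 3 → MvPolynomial (Fin n) k) : Prop where
  su1_fst : G 0 - F 0 ∈ Algebra.adjoin k {F 1, F 2}
  su1_snd : G 1 - F 1 ∈ Algebra.adjoin k {F 2}
  su1_trd : G 2 - F 2 ∈ Algebra.adjoin k {G 0, G 1}
  su2_fst : wdeg w (F 0) ≤ wdeg w (G 0)
  su2_snd : wdeg w (F 1) ≤ wdeg w (G 1)
  su3_deg : wdeg w (G 1) < wdeg w (G 0)
  su3_lead : lead w (G 0) ∉ Algebra.adjoin k {lead w (G 1)}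
  su4_deg : wdeg w (F 2) ≤ wdeg w (G 0)
  su4_lead : lead w (F 2) ∉ Algebra.adjoin k {lead w (G 0), lead w (G 1)}
  su5 : wdeg w (G 2) < wdeg w (F 2)
  su6 : wdeg w (G 2) + wdeg w (G 1) < wdeg w (G 0) + formDeg w (dWedge (G 0) (G 1))

end Defs

end ShestakovUmirbaev

/-!
The engine is the Shestakov–Umirbaev inequality for two polynomials `f`, `g`, in the form
`wdeg_aeval_dichotomy`. Let `P` be a bivariate polynomial. If the leading forms cancel in
`P(f, g)`, then `f ^ w` and `g ^ w` satisfy a weighted homogeneous relation. As `k[x]` is integrally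
closed this forces `(g ^ w) ^ p = c (f ^ w) ^ q` with `p`, `q` coprime (`exists_pow_eq`), and
`T = Y ^ p - c X ^ q` divides every relation (`binomialRel_dvd`). Write the leading form of `P` as
`T ^ m Q` with `Q(f ^ w, g ^ w) ≠ 0`. From `df ∧ dP(f, g) = (∂P/∂Y)(f, g) df ∧ dg` one gets
`deg P(f, g) ≥ deg (∂P/∂Y)(f, g) + deg df ∧ dg - deg f`, and the leading form of `∂P/∂Y` has one
factor `T` fewer; after `m` derivatives there is no cancellation left. On the other hand
`deg T ^ m ≤ deg P`, so `deg P(f, g)` is bounded below by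
`p deg g + deg df ∧ dg - deg f - deg g` whenever the latter is nonnegative.

For a quasi Shestakov–Umirbaev pair this applies to `f₃ - g₃ = P(g₂, g₁)`: its leading form is
that of `f₃`, which is not in `k[g₁ ^ w, g₂ ^ w]`, so there is cancellation, and
`deg f₃ ≤ deg g₁` leaves only `p = 2` and `q = s` odd. The same computation bounds
`deg df₂ ∧ df₃ = deg dg₂ ∧ d(f₃ - g₃)` below by `s δ + deg dg₁ ∧ dg₂`, and the degree of
`dg₁ ∧ df₃` is obtained by comparing the two partial derivatives of `P`
(`wdeg_aeval_pderiv_add`); this is `QuasiSU.exists_core`.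

With `deg df₂ ∧ df₃` so large, the inequality excludes cancellation in polynomials in `f₂`, `f₃` of
degree at most `s δ`, and only the monomials `f₃ ^ 2`, `f₃` and powers of `f₂` are small enough
(`Core.exists_quadratic`). Hence `g₁ = f₁ + a f₃ ^ 2 + c f₃ + ψ` and `g₂ = f₂ + b f₃ + d`.
Expanding `dg₁ ∧ dg₂`, whose degree is small, in terms of the `df_i ∧ df_j`
(`dWedge_eq_of_expansion`) gives the degree of `df₁ ∧ df₂` and the uniqueness of `a`, `b`, `c`.
The remaining statements follow by comparing leading forms and by applying the inequality to the
pairs `(f₃, f₁)` and `(f₂, f₁)`.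
-/

namespace ShestakovUmirbaev

/-! ### Weighted degrees and leading forms -/

section Degree

variable {k : Type*} [Field k] {Γ : Type*} [AddCommGroup Γ] [LinearOrder Γ] {n : ℕ}
  {w : Fin n → Γ} {f g : MvPolynomial (Fin n) k} {γ μ : Γ}

theorem wdeg_le_iff {b : WithBot Γ} :
    wdeg w f ≤ b ↔ ∀ d, coeff d f ≠ 0 → (Finsupp.weight w d : WithBot Γ) ≤ b := by
  simp [wdeg, weightedTotalDegree', Finset.sup_le_iff]

theorem weight_le_wdeg {d : Fin n →₀ ℕ} (h : coeff d f ≠ 0) :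
    (Finsupp.weight w d : WithBot Γ) ≤ wdeg w f :=
  wdeg_le_iff.1 le_rfl d h

theorem wdeg_eq_bot_iff : wdeg w f = ⊥ ↔ f = 0 :=
  weightedTotalDegree'_eq_bot_iff w f

@[simp] theorem wdeg_zero : wdeg w (0 : MvPolynomial (Fin n) k) = ⊥ :=
  wdeg_eq_bot_iff.2 rfl

theorem exists_wdeg_eq (w : Fin n → Γ) (hf : f ≠ 0) : ∃ γ : Γ, wdeg w f = γ := by
  obtain ⟨γ, h⟩ := WithBot.ne_bot_iff_exists.1 (mt (wdeg_eq_bot_iff (w := w)).1 hf)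
  exact ⟨γ, h.symm⟩

theorem ne_zero_of_wdeg_eq (h : wdeg w f = γ) : f ≠ 0 := by
  rintro rfl
  simp at h

theorem wdeg_add_le (f g : MvPolynomial (Fin n) k) :
    wdeg w (f + g) ≤ max (wdeg w f) (wdeg w g) := by
  refine wdeg_le_iff.2 fun d hd => ?_
  by_cases hf : coeff d f = 0
  · have : coeff d g ≠ 0 := fun hg => hd (by simp [hf, hg])
    exact (weight_le_wdeg this).trans (le_max_right _ _)
  · exact (weight_le_wdeg hf).trans (le_max_left _ _)

@[simp] theorem wdeg_neg (f : MvPolynomial (Fin n) k) : wdeg w (-f) = wdeg w f := by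
  simp [wdeg, weightedTotalDegree', support_neg]

theorem wdeg_sub_le (f g : MvPolynomial (Fin n) k) :
    wdeg w (f - g) ≤ max (wdeg w f) (wdeg w g) := by
  simpa [sub_eq_add_neg] using wdeg_add_le (w := w) f (-g)

theorem wdeg_add_eq_left (h : wdeg w g < wdeg w f) : wdeg w (f + g) = wdeg w f := by
  refine le_antisymm ((wdeg_add_le f g).trans (max_le le_rfl h.le)) ?_
  by_contra! h'
  have := wdeg_sub_le (w := w) (f + g) g
  rw [add_sub_cancel_right] at this
  exact absurd this (not_le.2 (max_lt h' h))

theorem wdeg_sum_le {ι : Type*} (s : Finset ι) (F : ι → MvPolynomial (Fin n) k) {b : WithBot Γ}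
    (h : ∀ i ∈ s, wdeg w (F i) ≤ b) : wdeg w (∑ i ∈ s, F i) ≤ b := by
  classical
  induction s using Finset.induction_on with
  | empty => simp
  | insert a s ha ih =>
    rw [Finset.sum_insert ha]
    exact (wdeg_add_le _ _).trans (max_le (h a (by simp))
      (ih fun i hi => h i (by simp [hi])))

/-- The component of `f` in degree `γ` vanishes above the degree of `f`. -/
theorem component_eq_zero_of_wdeg_lt (h : wdeg w f < γ) :
    weightedHomogeneousComponent w γ f = 0 := by
  classical
  ext d
  rw [coeff_weightedHomogeneousComponent, coeff_zero]
  split_ifs with hd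
  · by_contra hc
    exact absurd (weight_le_wdeg (w := w) hc) (by rw [hd]; exact not_le.2 h)
  · rfl

theorem le_wdeg_of_component_ne_zero (h : weightedHomogeneousComponent w γ f ≠ 0) :
    γ ≤ wdeg w f :=
  not_lt.1 (mt component_eq_zero_of_wdeg_lt h)

theorem component_ne_zero (h : wdeg w f = γ) : weightedHomogeneousComponent w γ f ≠ 0 := by
  classical
  intro h0
  have hf := ne_zero_of_wdeg_eq h
  obtain ⟨d, hd, hd'⟩ := Finset.exists_mem_eq_sup f.support (support_nonempty.2 hf)
    (fun s => (Finsupp.weight w s : WithBot Γ))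
  have h1 : (Finsupp.weight w d : WithBot Γ) = γ := by
    rw [← h]; exact hd'.symm
  have := congrArg (coeff d) h0
  rw [coeff_weightedHomogeneousComponent, if_pos (WithBot.coe_injective h1), coeff_zero] at this
  exact (mem_support_iff.1 hd) this

theorem lead_eq_component (h : wdeg w f = γ) :
    lead w f = weightedHomogeneousComponent w γ f := by
  simp [lead, h]

theorem lead_ne_zero (h : wdeg w f = γ) : lead w f ≠ 0 := by
  rw [lead_eq_component h]; exact component_ne_zero h

theorem wdeg_eq_of_component_ne_zero (h : wdeg w f ≤ γ)
    (h' : weightedHomogeneousComponent w γ f ≠ 0) : wdeg w f = γ :=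
  le_antisymm h (le_wdeg_of_component_ne_zero h')

omit [LinearOrder Γ] in
theorem component_isWeightedHomogeneous (w : Fin n → Γ) (γ : Γ) (f : MvPolynomial (Fin n) k) :
    IsWeightedHomogeneous w (weightedHomogeneousComponent w γ f) γ :=
  weightedHomogeneousComponent_isWeightedHomogeneous γ f

theorem wdeg_le_of_isWeightedHomogeneous (h : IsWeightedHomogeneous w f γ) : wdeg w f ≤ γ :=
  wdeg_le_iff.2 fun _ hd => by rw [h hd]

theorem wdeg_of_isWeightedHomogeneous (h : IsWeightedHomogeneous w f γ) (hf : f ≠ 0) :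
    wdeg w f = γ := by
  refine wdeg_eq_of_component_ne_zero (wdeg_le_of_isWeightedHomogeneous h) ?_
  rwa [h.weightedHomogeneousComponent_same]

theorem wdeg_lead (w : Fin n → Γ) (f : MvPolynomial (Fin n) k) :
    wdeg w (lead w f) = wdeg w f := by
  rcases eq_or_ne f 0 with rfl | hf
  · simp [lead]
  obtain ⟨γ, h⟩ := exists_wdeg_eq w hf
  rw [h, lead_eq_component h]
  exact wdeg_of_isWeightedHomogeneous (component_isWeightedHomogeneous w γ f) (component_ne_zero h)

theorem lead_lead (w : Fin n → Γ) (f : MvPolynomial (Fin n) k) :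
    lead w (lead w f) = lead w f := by
  rcases eq_or_ne f 0 with rfl | hf
  · simp [lead]
  obtain ⟨γ, h⟩ := exists_wdeg_eq w hf
  rw [lead_eq_component ((wdeg_lead w f).trans h), lead_eq_component h,
    (component_isWeightedHomogeneous w γ f).weightedHomogeneousComponent_same]

theorem lead_add_eq_left (h : wdeg w g < wdeg w f) : lead w (f + g) = lead w f := by
  have hf : f ≠ 0 := by rintro rfl; simp at h
  obtain ⟨γ, hγ⟩ := exists_wdeg_eq w hf
  rw [lead_eq_component hγ, lead_eq_component ((wdeg_add_eq_left h).trans hγ), map_add,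
    component_eq_zero_of_wdeg_lt (h.trans_eq hγ), add_zero]

theorem wdeg_C (w : Fin n → Γ) {c : k} (hc : c ≠ 0) :
    wdeg w (C c : MvPolynomial (Fin n) k) = (0 : Γ) :=
  wdeg_of_isWeightedHomogeneous (isWeightedHomogeneous_C w c) (by simpa using hc)

theorem wdeg_C_le (w : Fin n → Γ) (c : k) :
    wdeg w (C c : MvPolynomial (Fin n) k) ≤ (0 : Γ) :=
  wdeg_le_of_isWeightedHomogeneous (isWeightedHomogeneous_C w c)

theorem wdeg_X (w : Fin n → Γ) (i : Fin n) :
    wdeg w (X i : MvPolynomial (Fin n) k) = w i :=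
  wdeg_of_isWeightedHomogeneous (isWeightedHomogeneous_X k w i) (X_ne_zero i)

variable [IsOrderedAddMonoid Γ]

/-- Components of top degree multiply. -/
theorem component_mul (hf : wdeg w f ≤ γ) (hg : wdeg w g ≤ μ) :
    weightedHomogeneousComponent w (γ + μ) (f * g) =
      weightedHomogeneousComponent w γ f * weightedHomogeneousComponent w μ g := by
  classical
  ext d
  rw [coeff_weightedHomogeneousComponent, coeff_mul, coeff_mul]
  have key : ∀ x ∈ Finset.HasAntidiagonal.antidiagonal d, coeff x.1 f * coeff x.2 g ≠ 0 →
      (Finsupp.weight w d = γ + μ ↔ Finsupp.weight w x.1 = γ ∧ Finsupp.weight w x.2 = μ) := by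
    intro x hx hne
    have h1 := WithBot.coe_le_coe.1 ((weight_le_wdeg (left_ne_zero_of_mul hne)).trans hf)
    have h2 := WithBot.coe_le_coe.1 ((weight_le_wdeg (right_ne_zero_of_mul hne)).trans hg)
    rw [← Finset.HasAntidiagonal.mem_antidiagonal.1 hx, map_add]
    constructor
    · exact (add_eq_add_iff_eq_and_eq h1 h2).1
    · rintro ⟨h, h'⟩
      rw [h, h']
  split_ifs with hd
  · refine Finset.sum_congr rfl fun x hx => ?_
    by_cases hne : coeff x.1 f * coeff x.2 g = 0
    · simp only [coeff_weightedHomogeneousComponent]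
      split_ifs <;> simp_all
    · obtain ⟨h1, h2⟩ := (key x hx hne).1 hd
      rw [coeff_weightedHomogeneousComponent, coeff_weightedHomogeneousComponent, if_pos h1,
        if_pos h2]
  · refine (Finset.sum_eq_zero fun x hx => ?_).symm
    by_cases hne : coeff x.1 f * coeff x.2 g = 0
    · simp only [coeff_weightedHomogeneousComponent]
      split_ifs <;> simp_all
    · have := mt (key x hx hne).2 hd
      simp only [coeff_weightedHomogeneousComponent]
      split_ifs <;> simp_all

theorem wdeg_mul_le_of_le (hf : wdeg w f ≤ γ) (hg : wdeg w g ≤ μ) :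
    wdeg w (f * g) ≤ (γ + μ : Γ) := by
  classical
  refine wdeg_le_iff.2 fun d hd => ?_
  rw [coeff_mul] at hd
  obtain ⟨x, hx, hne⟩ := Finset.exists_ne_zero_of_sum_ne_zero hd
  rw [← Finset.HasAntidiagonal.mem_antidiagonal.1 hx, map_add, WithBot.coe_le_coe]
  exact add_le_add
    (WithBot.coe_le_coe.1 ((weight_le_wdeg (left_ne_zero_of_mul hne)).trans hf))
    (WithBot.coe_le_coe.1 ((weight_le_wdeg (right_ne_zero_of_mul hne)).trans hg))

theorem wdeg_mul_of_eq (hf : wdeg w f = γ) (hg : wdeg w g = μ) :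
    wdeg w (f * g) = (γ + μ : Γ) := by
  refine wdeg_eq_of_component_ne_zero (wdeg_mul_le_of_le hf.le hg.le) ?_
  rw [component_mul hf.le hg.le]
  exact mul_ne_zero (component_ne_zero hf) (component_ne_zero hg)

theorem wdeg_mul (f g : MvPolynomial (Fin n) k) :
    wdeg w (f * g) = wdeg w f + wdeg w g := by
  rcases eq_or_ne f 0 with rfl | hf
  · simp
  rcases eq_or_ne g 0 with rfl | hg
  · simp
  obtain ⟨γ, h⟩ := exists_wdeg_eq w hf
  obtain ⟨μ, h'⟩ := exists_wdeg_eq w hg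
  rw [wdeg_mul_of_eq h h', h, h', WithBot.coe_add]

theorem lead_mul (f g : MvPolynomial (Fin n) k) :
    lead w (f * g) = lead w f * lead w g := by
  rcases eq_or_ne f 0 with rfl | hf
  · simp [lead]
  rcases eq_or_ne g 0 with rfl | hg
  · simp [lead]
  obtain ⟨γ, h⟩ := exists_wdeg_eq w hf
  obtain ⟨μ, h'⟩ := exists_wdeg_eq w hg
  rw [lead_eq_component (wdeg_mul_of_eq h h'), component_mul h.le h'.le, lead_eq_component h,
    lead_eq_component h']

theorem wdeg_C_mul {c : k} (hc : c ≠ 0) (f : MvPolynomial (Fin n) k) :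
    wdeg w (C c * f) = wdeg w f := by
  rw [wdeg_mul, wdeg_C w hc, WithBot.coe_zero, zero_add]

theorem wdeg_C_mul_le (c : k) (f : MvPolynomial (Fin n) k) :
    wdeg w (C c * f) ≤ wdeg w f := by
  rcases eq_or_ne c 0 with rfl | hc
  · simp
  · exact (wdeg_C_mul hc f).le

omit [IsOrderedAddMonoid Γ] in
theorem lead_C (w : Fin n → Γ) (c : k) : lead w (C c : MvPolynomial (Fin n) k) = C c := by
  rcases eq_or_ne c 0 with rfl | hc
  · simp [lead]
  · rw [lead_eq_component (wdeg_C w hc),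
      (isWeightedHomogeneous_C w c).weightedHomogeneousComponent_same]

theorem lead_C_mul (c : k) (f : MvPolynomial (Fin n) k) :
    lead w (C c * f) = C c * lead w f := by
  rw [lead_mul, lead_C]

theorem wdeg_pow (h : wdeg w f = γ) (m : ℕ) : wdeg w (f ^ m) = (m • γ : Γ) := by
  induction m with
  | zero => simpa using wdeg_C w (one_ne_zero (α := k))
  | succ m ih => rw [pow_succ, wdeg_mul_of_eq ih h, succ_nsmul]

theorem lead_pow (f : MvPolynomial (Fin n) k) (m : ℕ) :
    lead w (f ^ m) = lead w f ^ m := by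
  induction m with
  | zero => simpa using lead_C w (1 : k)
  | succ m ih => rw [pow_succ, lead_mul, ih, pow_succ]

theorem weight_nonneg (hw : ∀ i, 0 < w i) (d : Fin n →₀ ℕ) : 0 ≤ Finsupp.weight w d := by
  rw [Finsupp.weight_apply]
  exact Finset.sum_nonneg fun i _ => nsmul_nonneg (hw i).le _

theorem wdeg_nonneg (hw : ∀ i, 0 < w i) (h : wdeg w f = γ) : 0 ≤ γ := by
  obtain ⟨d, hd⟩ := ne_zero_iff.1 (ne_zero_of_wdeg_eq h)
  exact (weight_nonneg hw d).trans (WithBot.coe_le_coe.1 (h ▸ weight_le_wdeg hd))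

theorem eq_C_of_wdeg_le_zero (hw : ∀ i, 0 < w i) (h : wdeg w f ≤ (0 : Γ)) :
    f = C (coeff 0 f) := by
  classical
  ext d
  rw [coeff_C]
  split_ifs with hd
  · rw [hd]
  · by_contra hc
    obtain ⟨i, hi⟩ : ∃ i, d i ≠ 0 := by
      by_contra! h0
      exact hd (by ext i; simp [h0 i])
    have h1 := WithBot.coe_le_coe.1 ((weight_le_wdeg hc).trans h)
    rw [Finsupp.weight_apply] at h1
    have h2 : 0 < d i • w i := nsmul_pos (hw i) hi
    have h3 : d i • w i ≤ d.sum fun i c => c • w i :=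
      Finset.single_le_sum (f := fun i => d i • w i)
        (fun i _ => nsmul_nonneg (hw i).le _) (Finsupp.mem_support_iff.2 hi)
    exact absurd (h2.trans_le (h3.trans h1)) (lt_irrefl _)

end Degree

/-! ### Substitution and the chain rule -/

section Substitution

variable {k : Type*} [Field k] {Γ : Type*} [AddCommGroup Γ] [LinearOrder Γ]
  [IsOrderedAddMonoid Γ] {n m : ℕ} {w : Fin n → Γ}

theorem wdeg_prod_pow_le {v : Fin m → MvPolynomial (Fin n) k} {α : Fin m → Γ}
    (hv : ∀ i, wdeg w (v i) ≤ α i) (d : Fin m →₀ ℕ) :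
    wdeg w (∏ i, v i ^ d i) ≤ (Finsupp.weight α d : Γ) ∧
      weightedHomogeneousComponent w (Finsupp.weight α d) (∏ i, v i ^ d i) =
        ∏ i, weightedHomogeneousComponent w (α i) (v i) ^ d i := by
  have hpow : ∀ (i : Fin m) (e : ℕ), wdeg w (v i ^ e) ≤ (e • α i : Γ) ∧
      weightedHomogeneousComponent w (e • α i) (v i ^ e) =
        weightedHomogeneousComponent w (α i) (v i) ^ e := by
    intro i e
    induction e with
    | zero =>
      rw [pow_zero, pow_zero, zero_smul]
      exact ⟨wdeg_C_le w 1, (isWeightedHomogeneous_one k w).weightedHomogeneousComponent_same⟩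
    | succ e ih =>
      rw [pow_succ, pow_succ, succ_nsmul]
      exact ⟨wdeg_mul_le_of_le ih.1 (hv i), by rw [component_mul ih.1 (hv i), ih.2]⟩
  have hprod : ∀ s : Finset (Fin m), wdeg w (∏ i ∈ s, v i ^ d i) ≤ (∑ i ∈ s, d i • α i : Γ) ∧
      weightedHomogeneousComponent w (∑ i ∈ s, d i • α i) (∏ i ∈ s, v i ^ d i) =
        ∏ i ∈ s, weightedHomogeneousComponent w (α i) (v i) ^ d i := by
    intro s
    induction s using Finset.induction_on with
    | empty =>
      rw [Finset.prod_empty, Finset.prod_empty, Finset.sum_empty]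
      exact ⟨wdeg_C_le w 1, (isWeightedHomogeneous_one k w).weightedHomogeneousComponent_same⟩
    | insert a s ha ih =>
      rw [Finset.prod_insert ha, Finset.prod_insert ha, Finset.sum_insert ha]
      exact ⟨wdeg_mul_le_of_le (hpow a _).1 ih.1,
        by rw [component_mul (hpow a _).1 ih.1, ih.2, (hpow a _).2]⟩
  have hwt : Finsupp.weight α d = ∑ i, d i • α i := by
    rw [Finsupp.weight_apply]
    exact Finsupp.sum_fintype _ _ fun i => zero_smul _ _
  rw [hwt]
  exact hprod Finset.univ

/-- Substituting polynomials of degrees at most `α i` into a polynomial `P` of `α`-weighted degree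
at most `D` gives a polynomial of degree at most `D`, whose component of degree `D` is obtained by
substituting the components of degree `α i` into the component of `P` of degree `D`. -/
theorem component_aeval {v : Fin m → MvPolynomial (Fin n) k} {α : Fin m → Γ}
    (hv : ∀ i, wdeg w (v i) ≤ α i) {P : MvPolynomial (Fin m) k} {D : Γ} (hP : wdeg α P ≤ D) :
    wdeg w (aeval v P) ≤ D ∧
      weightedHomogeneousComponent w D (aeval v P) =
        aeval (fun i => weightedHomogeneousComponent w (α i) (v i))
          (weightedHomogeneousComponent α D P) := by
  classical
  have h1 : aeval v P = ∑ d ∈ P.support, C (coeff d P) * ∏ i, v i ^ d i := by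
    conv_lhs => rw [P.as_sum, map_sum]
    refine Finset.sum_congr rfl fun d _ => ?_
    rw [aeval_monomial, Finsupp.prod_fintype _ _ (by simp)]
    rfl
  have hle : ∀ d ∈ P.support, Finsupp.weight α d ≤ D := fun d hd =>
    WithBot.coe_le_coe.1 ((weight_le_wdeg (mem_support_iff.1 hd)).trans hP)
  constructor
  · rw [h1]
    refine wdeg_sum_le _ _ fun d hd => (wdeg_C_mul_le _ _).trans
      ((wdeg_prod_pow_le hv d).1.trans (WithBot.coe_le_coe.2 (hle d hd)))
  · rw [h1, map_sum, weightedHomogeneousComponent_apply, map_sum, Finset.sum_filter]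
    refine Finset.sum_congr rfl fun d hd => ?_
    rw [weightedHomogeneousComponent_C_mul]
    split_ifs with h
    · rw [← h, (wdeg_prod_pow_le hv d).2, aeval_monomial, Finsupp.prod_fintype _ _ (by simp)]
      rfl
    · rw [component_eq_zero_of_wdeg_lt, mul_zero]
      exact (wdeg_prod_pow_le hv d).1.trans_lt
        (WithBot.coe_lt_coe.2 (lt_of_le_of_ne (hle d hd) h))

/-- The chain rule for a derivation applied to a polynomial expression. -/
theorem derivation_aeval {A M : Type*} [CommRing A] [Algebra k A] [AddCommGroup M] [Module A M]
    [Module k M] [IsScalarTower k A M] (d : Derivation k A M) (v : Fin m → A)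
    (P : MvPolynomial (Fin m) k) :
    d (aeval v P) = ∑ i, aeval v (pderiv i P) • d (v i) := by
  induction P using MvPolynomial.induction_on with
  | C a => simp
  | add p q hp hq => simp [hp, hq, add_smul, Finset.sum_add_distrib]
  | mul_X p j hp =>
    have : ∀ i, aeval v (pderiv i (p * X j)) • d (v i) =
        v j • aeval v (pderiv i p) • d (v i) + if i = j then aeval v p • d (v j) else 0 := by
      intro i
      rw [Derivation.leibniz, pderiv_X, Pi.single_apply]
      by_cases h : i = j
      · subst h
        simp [add_smul, smul_smul, add_comm]
      · simp [h, Ne.symm h, smul_smul]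
    simp only [this, Finset.sum_add_distrib, Finset.sum_ite_eq', Finset.mem_univ, if_true]
    rw [map_mul, aeval_X, Derivation.leibniz, hp, Finset.smul_sum, add_comm]

end Substitution

/-! ### Relations between two homogeneous polynomials -/

section Relation

variable {k : Type*} [Field k] {Γ : Type*} [AddCommGroup Γ] [LinearOrder Γ]
  [IsOrderedAddMonoid Γ] {n : ℕ} {w : Fin n → Γ} {α β : Γ}

omit [LinearOrder Γ] [IsOrderedAddMonoid Γ] in
theorem weight_pair (d : Fin 2 →₀ ℕ) :
    Finsupp.weight ![α, β] d = d 0 • α + d 1 • β := by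
  rw [Finsupp.weight_apply, Finsupp.sum_fintype _ _ (by simp)]
  simp

omit [LinearOrder Γ] [IsOrderedAddMonoid Γ] in
theorem pair_ext {d d' : Fin 2 →₀ ℕ} (h0 : d 0 = d' 0) (h1 : d 1 = d' 1) : d = d' := by
  ext i
  fin_cases i
  · exact h0
  · exact h1

theorem nsmul_injective_of_pos (hα : 0 < α) : Function.Injective fun m : ℕ => m • α :=
  StrictMono.injective fun _ _ h => nsmul_lt_nsmul_left hα h

theorem mul_pow_div_pow {K : Type*} [Field K] (a c : K) {b : K} (hb : b ≠ 0)
    (p q x y t : ℕ) : c * (a ^ (x + q * t) * b ^ y) =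
      a ^ x * b ^ (y + p * t) * (c * (a ^ q / b ^ p) ^ t) := by
  rw [div_pow, ← pow_mul, ← pow_mul, pow_add, pow_add]
  field_simp

/-- The bivariate monomials of a given weight form an arithmetic progression with step
`(q, -p)`, where `p β = q α` and `p`, `q` are coprime. -/
theorem exists_step {p q : ℕ} (hα : 0 < α) (hβ : 0 < β) (hq : 0 < q) (hpq : Nat.Coprime p q)
    (h : p • β = q • α) {x y x₀ y₀ : ℕ} (hx : x₀ ≤ x) (hxy : x • α + y • β = x₀ • α + y₀ • β) :
    ∃ t, x = x₀ + q * t ∧ y₀ = y + p * t := by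
  obtain ⟨u, rfl⟩ := Nat.exists_eq_add_of_le hx
  have hy : y ≤ y₀ := by
    by_contra! hlt
    have h1 : x₀ • α ≤ (x₀ + u) • α := nsmul_le_nsmul_left hα.le hx
    have h2 : y₀ • β < y • β := nsmul_lt_nsmul_left hβ hlt
    exact absurd hxy (ne_of_gt (add_lt_add_of_le_of_lt h1 h2))
  obtain ⟨v, rfl⟩ := Nat.exists_eq_add_of_le hy
  have h1 : u • α = v • β := by
    rw [add_nsmul, add_nsmul] at hxy
    have : (x₀ • α + y • β) + u • α = (x₀ • α + y • β) + v • β := by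
      rw [← sub_eq_zero] at hxy ⊢
      rw [← hxy]; abel
    exact add_left_cancel this
  have h2 : (p * u) • α = (q * v) • α := by
    rw [mul_nsmul', h1, ← mul_nsmul', mul_comm p v, mul_nsmul', h, ← mul_nsmul', mul_comm]
  have h3 : p * u = q * v := nsmul_injective_of_pos hα h2
  obtain ⟨t, rfl⟩ := (Nat.Coprime.symm hpq).dvd_of_dvd_mul_left ⟨v, h3⟩
  refine ⟨t, rfl, ?_⟩
  have : q * (p * t) = q * v := by rw [← h3]; ring
  rw [Nat.eq_of_mul_eq_mul_left hq this]

variable {h₁ h₂ : MvPolynomial (Fin n) k}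

/-- A weighted homogeneous polynomial `H ≠ 0` with `H(h₁, h₂) = 0` has at least two monomials,
and these have different exponents of the first variable. -/
theorem exists_two_monomials (hβ : 0 < β) (hh₁ : h₁ ≠ 0) (hh₂ : h₂ ≠ 0)
    {H : MvPolynomial (Fin 2) k} {D : Γ} (hH : IsWeightedHomogeneous ![α, β] H D) (hH0 : H ≠ 0)
    (hev : aeval ![h₁, h₂] H = 0) :
    ∃ d ∈ H.support, (∀ d' ∈ H.support, d 0 ≤ d' 0) ∧ ∃ d' ∈ H.support, d 0 < d' 0 := by
  classical
  obtain ⟨d, hd, hmin⟩ := Finset.exists_min_image H.support (fun d => d 0)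
    (support_nonempty.2 hH0)
  refine ⟨d, hd, hmin, ?_⟩
  by_contra! hmax
  have hsupp : ∀ d' ∈ H.support, d' = d := by
    intro d' hd'
    have h0 : d' 0 = d 0 := le_antisymm (hmax d' hd') (hmin d' hd')
    refine pair_ext h0 ?_
    have h1 := (hH (mem_support_iff.1 hd')).trans (hH (mem_support_iff.1 hd)).symm
    rw [weight_pair, weight_pair, h0] at h1
    exact nsmul_injective_of_pos hβ (add_left_cancel h1)
  have hmon : H = monomial d (coeff d H) := by
    ext d'
    rw [coeff_monomial]
    split_ifs with h
    · rw [h]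
    · exact notMem_support_iff.1 fun h' => h (hsupp d' h').symm
  rw [hmon, aeval_monomial, Finsupp.prod_fintype _ _ (by simp)] at hev
  simp [hh₁, hh₂, mem_support_iff.1 hd] at hev

/-- Homogeneous polynomials `h₁`, `h₂` of positive degree satisfying a nontrivial weighted
homogeneous relation have proportional powers: `h₁ ^ q / h₂ ^ p` is algebraic over `k`, hence
integral over the integrally closed ring `k[x]`, hence a polynomial, which has degree zero. -/
theorem exists_pow_eq (hw : ∀ i, 0 < w i) (hα : 0 < α) (hβ : 0 < β) (hh₁ : wdeg w h₁ = α)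
    (hh₂ : wdeg w h₂ = β) {H : MvPolynomial (Fin 2) k} {D : Γ}
    (hH : IsWeightedHomogeneous ![α, β] H D) (hH0 : H ≠ 0) (hev : aeval ![h₁, h₂] H = 0) :
    ∃ p q : ℕ, 0 < p ∧ 0 < q ∧ Nat.Coprime p q ∧ p • β = q • α ∧
      ∃ c : k, c ≠ 0 ∧ h₂ ^ p = C c * h₁ ^ q := by
  classical
  have h₁0 := ne_zero_of_wdeg_eq hh₁
  have h₂0 := ne_zero_of_wdeg_eq hh₂
  obtain ⟨d, hd, hmin, d', hd', hlt⟩ := exists_two_monomials hβ h₁0 h₂0 hH hH0 hev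
  have hwt : ∀ e ∈ H.support, e 0 • α + e 1 • β = d 0 • α + d 1 • β := fun e he => by
    rw [← weight_pair, ← weight_pair, hH (mem_support_iff.1 he), hH (mem_support_iff.1 hd)]
  obtain ⟨p, q, hp, hq, hpq, hrel⟩ :
      ∃ p q : ℕ, 0 < p ∧ 0 < q ∧ Nat.Coprime p q ∧ p • β = q • α := by
    have h1 := hwt d' hd'
    obtain ⟨a, ha⟩ := Nat.exists_eq_add_of_lt hlt
    have hd1 : d' 1 < d 1 := by
      by_contra! hle
      have h2 : d 0 • α < d' 0 • α := nsmul_lt_nsmul_left hα hlt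
      have h3 : d 1 • β ≤ d' 1 • β := nsmul_le_nsmul_left hβ.le hle
      exact absurd h1 (ne_of_gt (add_lt_add_of_lt_of_le h2 h3))
    obtain ⟨b, hb⟩ := Nat.exists_eq_add_of_lt hd1
    have h2 : (a + 1) • α = (b + 1) • β := by
      rw [ha, hb, add_assoc, add_assoc, add_nsmul, add_nsmul _ (d' 1)] at h1
      rw [← sub_eq_zero] at h1 ⊢
      rw [← h1]; abel
    obtain ⟨g, p, q, hg, hpq, h3, h4⟩ := Nat.exists_coprime' (m := b + 1) (n := a + 1)
      (Nat.gcd_pos_of_pos_left _ (Nat.succ_pos b))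
    refine ⟨p, q, ?_, ?_, hpq, ?_⟩
    · exact Nat.pos_of_ne_zero fun h => by simp [h] at h3
    · exact Nat.pos_of_ne_zero fun h => by simp [h] at h4
    · rw [h3, h4, mul_comm p, mul_comm q, mul_nsmul', mul_nsmul'] at h2
      exact (nsmul_right_injective hg.ne' h2).symm
  refine ⟨p, q, hp, hq, hpq, hrel, ?_⟩
  have hstep : ∀ e ∈ H.support, ∃ t, e 0 = d 0 + q * t ∧ d 1 = e 1 + p * t := fun e he =>
    exists_step hα hβ hq hpq hrel (hmin e he) (hwt e he)
  choose! t ht using hstep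
  -- Dividing the relation by `h₁ ^ d 0 * h₂ ^ d 1` gives a polynomial equation `U(z) = 0` over `k`
  -- for `z = h₁ ^ q / h₂ ^ p`; its constant coefficient belongs to the monomial `d`.
  let K := FractionRing (MvPolynomial (Fin n) k)
  let ι := algebraMap (MvPolynomial (Fin n) k) K
  have hι : ∀ {f}, f ≠ 0 → ι f ≠ 0 := fun hf =>
    (map_ne_zero_iff ι (IsFractionRing.injective _ K)).2 hf
  let z : K := ι h₁ ^ q / ι h₂ ^ p
  let U : Polynomial k := ∑ e ∈ H.support, Polynomial.monomial (t e) (coeff e H)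
  have hU : U ≠ 0 := by
    intro h0
    have hc : U.coeff 0 = coeff d H := by
      simp only [U, Polynomial.finsetSum_coeff, Polynomial.coeff_monomial]
      rw [Finset.sum_eq_single_of_mem d hd]
      · rw [if_pos]
        have := (ht d hd).1
        rcases Nat.eq_zero_or_pos (t d) with h | h
        · exact h
        · have := Nat.mul_pos hq h; omega
      · intro e he hne
        rw [if_neg]
        intro h
        have := ht e he
        rw [h, mul_zero, mul_zero, add_zero, add_zero] at this
        exact hne (pair_ext this.1 this.2.symm)
    rw [h0, Polynomial.coeff_zero] at hc
    exact mem_support_iff.1 hd hc.symm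
  have hUz : Polynomial.aeval z U = 0 := by
    have h1 : ι (aeval ![h₁, h₂] H) = ι h₁ ^ d 0 * ι h₂ ^ d 1 * Polynomial.aeval z U := by
      simp only [U]
      conv_lhs => rw [H.as_sum]
      rw [map_sum, map_sum, map_sum, Finset.mul_sum]
      refine Finset.sum_congr rfl fun e he => ?_
      rw [aeval_monomial, Finsupp.prod_fintype _ _ (by simp), Polynomial.aeval_monomial]
      simp only [Fin.prod_univ_two, map_mul, map_pow, Matrix.cons_val_zero, Matrix.cons_val_one,
        (ht e he).1, (ht e he).2]
      rw [IsScalarTower.algebraMap_apply k (MvPolynomial (Fin n) k) K]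
      exact mul_pow_div_pow _ _ (hι h₂0) p q _ _ _
    rw [hev, map_zero] at h1
    exact (mul_eq_zero.1 h1.symm).resolve_left
      (mul_ne_zero (pow_ne_zero _ (hι h₁0)) (pow_ne_zero _ (hι h₂0)))
  have hint : IsIntegral (MvPolynomial (Fin n) k) z :=
    IsIntegral.tower_top (R := k) (isAlgebraic_iff_isIntegral.1 ⟨U, hU, hUz⟩)
  obtain ⟨u, hu⟩ := IsIntegrallyClosed.isIntegral_iff.1 hint
  have hu' : h₁ ^ q = u * h₂ ^ p := by
    apply IsFractionRing.injective (MvPolynomial (Fin n) k) K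
    rw [map_mul, map_pow, map_pow, hu]
    exact (div_mul_cancel₀ _ (pow_ne_zero _ (hι h₂0))).symm
  have hu0 : u ≠ 0 := by
    rintro rfl
    exact pow_ne_zero q h₁0 (by simpa using hu')
  obtain ⟨μ, hμ⟩ := exists_wdeg_eq w hu0
  -- Both powers have the same degree, so `u` is a constant.
  have hμ0 : μ = 0 := by
    have h1 := wdeg_pow hh₁ q
    rw [hu', wdeg_mul_of_eq hμ (wdeg_pow hh₂ p), WithBot.coe_inj, hrel] at h1
    exact add_eq_right.1 h1
  have huC := eq_C_of_wdeg_le_zero hw (hμ.trans (by rw [hμ0])).le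
  set c := coeff 0 u
  have hc : c ≠ 0 := by
    intro h
    rw [h, C_0] at huC
    exact hu0 huC
  refine ⟨c⁻¹, inv_ne_zero hc, ?_⟩
  rw [hu', huC, ← mul_assoc, ← C_mul, inv_mul_cancel₀ hc, C_1, one_mul]

/-- The binomial `Y ^ p - c X ^ q`. -/
noncomputable def binomialRel (p q : ℕ) (c : k) : MvPolynomial (Fin 2) k :=
  X 1 ^ p - C c * X 0 ^ q

theorem exists_binomialRel_mul_add (p q : ℕ) (hp : 0 < p) (c : k) (P : MvPolynomial (Fin 2) k) :
    ∃ Q R : MvPolynomial (Fin 2) k, P = binomialRel p q c * Q + R ∧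
      ∀ d ∈ R.support, d 1 < p := by
  classical
  have hmon : ∀ (y x : ℕ) (a : k), ∃ Q R : MvPolynomial (Fin 2) k,
      C a * X 0 ^ x * X 1 ^ y = binomialRel p q c * Q + R ∧ ∀ d ∈ R.support, d 1 < p := by
    intro y
    induction y using Nat.strong_induction_on with
    | _ y ih =>
      intro x a
      rcases lt_or_ge y p with hy | hy
      · refine ⟨0, _, by rw [mul_zero, zero_add], fun d hd => ?_⟩
        have h1 : C a * X 0 ^ x * X 1 ^ y =
            (monomial (Finsupp.single 0 x + Finsupp.single 1 y) a : MvPolynomial (Fin 2) k) := by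
          rw [X_pow_eq_monomial, X_pow_eq_monomial, C_mul_monomial, monomial_mul]; simp
        rw [h1] at hd
        have := Finset.mem_singleton.1 (support_monomial_subset hd)
        simpa [this] using hy
      · obtain ⟨y', rfl⟩ := Nat.exists_eq_add_of_le hy
        obtain ⟨Q, R, h1, h2⟩ := ih y' (by omega) (x + q) (a * c)
        refine ⟨C a * X 0 ^ x * X 1 ^ y' + Q, R, ?_, h2⟩
        rw [mul_add, add_assoc, ← h1, binomialRel, C_mul]
        ring
  induction P using MvPolynomial.induction_on' with
  | monomial d a =>
    obtain ⟨Q, R, h1, h2⟩ := hmon (d 1) (d 0) a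
    refine ⟨Q, R, ?_, h2⟩
    rw [← h1, monomial_eq, Finsupp.prod_fintype _ _ (by simp), Fin.prod_univ_two, mul_assoc]
  | add P P' ih ih' =>
    obtain ⟨Q, R, h1, h2⟩ := ih
    obtain ⟨Q', R', h1', h2'⟩ := ih'
    refine ⟨Q + Q', R + R', by rw [h1, h1']; ring, fun d hd => ?_⟩
    rcases Finset.mem_union.1 (support_add hd) with h | h
    · exact h2 d h
    · exact h2' d h

/-- If `p β = q α` with `p`, `q` coprime, every polynomial relation between homogeneous `h₁`,
`h₂` of degrees `α`, `β` with `h₂ ^ p = c h₁ ^ q` is a multiple of `Y ^ p - c X ^ q`: monomials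
with `Y`-exponent below `p` have pairwise different weights, so the remainder vanishes. -/
theorem binomialRel_dvd (hα : 0 < α) (hβ : 0 < β) (hh₁ : IsWeightedHomogeneous w h₁ α)
    (hh₂ : IsWeightedHomogeneous w h₂ β) (h₁0 : h₁ ≠ 0) (h₂0 : h₂ ≠ 0) {p q : ℕ} (hp : 0 < p)
    (hq : 0 < q) (hpq : Nat.Coprime p q) (hrel : p • β = q • α) {c : k}
    (hc : h₂ ^ p = C c * h₁ ^ q) {H : MvPolynomial (Fin 2) k} (hev : aeval ![h₁, h₂] H = 0) :
    binomialRel p q c ∣ H := by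
  classical
  obtain ⟨Q, R, rfl, hR⟩ := exists_binomialRel_mul_add p q hp c H
  have hT : aeval ![h₁, h₂] (binomialRel p q c) = 0 := by simp [binomialRel, hc, algebraMap_eq]
  rw [map_add, map_mul, hT, zero_mul, zero_add] at hev
  suffices R = 0 by simp [this]
  by_contra hR0
  obtain ⟨D, hD⟩ := exists_wdeg_eq ![α, β] hR0
  have hv : ∀ i, wdeg w (![h₁, h₂] i) ≤ (![α, β] i : Γ) := by
    intro i
    fin_cases i
    · exact wdeg_le_of_isWeightedHomogeneous hh₁
    · exact wdeg_le_of_isWeightedHomogeneous hh₂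
  have hcomp := (component_aeval hv hD.le).2
  have hv' : (fun i => weightedHomogeneousComponent w (![α, β] i) (![h₁, h₂] i)) = ![h₁, h₂] := by
    funext i
    fin_cases i
    · exact hh₁.weightedHomogeneousComponent_same
    · exact hh₂.weightedHomogeneousComponent_same
  rw [hv', hev, map_zero] at hcomp
  have hhom := component_isWeightedHomogeneous ![α, β] D R
  obtain ⟨d, hd, -, d', hd', hlt⟩ := exists_two_monomials hβ h₁0 h₂0 hhom (component_ne_zero hD)
    hcomp.symm
  have hwt : d' 0 • α + d' 1 • β = d 0 • α + d 1 • β := by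
    rw [← weight_pair, ← weight_pair, hhom (mem_support_iff.1 hd'), hhom (mem_support_iff.1 hd)]
  obtain ⟨t, ht0, ht1⟩ := exists_step hα hβ hq hpq hrel hlt.le hwt
  have htpos : 0 < t := Nat.pos_of_ne_zero fun h => by simp [h] at ht0; omega
  have hdp : d 1 < p := by
    refine hR d ?_
    rw [support_weightedHomogeneousComponent, Finset.mem_filter] at hd
    exact hd.1
  have : p * 1 ≤ p * t := Nat.mul_le_mul_left p htpos
  omega

end Relation

/-! ### The Shestakov–Umirbaev inequality -/

section Inequality

variable {k : Type*} [Field k] {Γ : Type*} [AddCommGroup Γ] [LinearOrder Γ] {n : ℕ}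
  {w : Fin n → Γ} {f g : MvPolynomial (Fin n) k} {α β : Γ}

variable [IsOrderedAddMonoid Γ]

/-- Partial derivatives lower degrees by the weight of the variable, and commute with taking
components. -/
theorem component_pderiv (i : Fin n) {P : MvPolynomial (Fin n) k} {D : Γ} (hP : wdeg w P ≤ D) :
    wdeg w (pderiv i P) ≤ (D - w i : Γ) ∧
      weightedHomogeneousComponent w (D - w i) (pderiv i P) =
        pderiv i (weightedHomogeneousComponent w D P) := by
  classical
  constructor
  · refine wdeg_le_iff.2 fun d hd => ?_
    rw [coeff_pderiv] at hd
    have := WithBot.coe_le_coe.1 ((weight_le_wdeg (left_ne_zero_of_mul hd)).trans hP)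
    rw [map_add, Finsupp.weight_single, one_nsmul] at this
    exact WithBot.coe_le_coe.2 (le_sub_iff_add_le.2 this)
  · ext d
    rw [coeff_weightedHomogeneousComponent, coeff_pderiv, coeff_pderiv,
      coeff_weightedHomogeneousComponent, map_add, Finsupp.weight_single, one_nsmul]
    simp only [eq_sub_iff_add_eq]
    split_ifs <;> simp

/-- Let `e` satisfy `deg (∂P/∂Y)(f, g) + e ≤ deg f + deg P(f, g)` for all `P`; here `e` is
`deg df ∧ dg`. If the component of `P` in degree `D` is `T ^ m Q`, where `T(f ^ w, g ^ w) = 0` is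
a simple relation and `Q(f ^ w, g ^ w) ≠ 0`, then `deg P(f, g) ≥ D + m (e - deg f - deg g)`. Each
differentiation in `Y` lowers `m` by one. -/
theorem le_wdeg_aeval_of_component_eq [CharZero k] {e : Γ} (hf : wdeg w f = α)
    (hg : wdeg w g = β)
    (he : ∀ P : MvPolynomial (Fin 2) k,
      wdeg w (aeval ![f, g] (pderiv 1 P)) + e ≤ α + wdeg w (aeval ![f, g] P))
    {T : MvPolynomial (Fin 2) k} (hT : aeval ![lead w f, lead w g] T = 0)
    (hT' : aeval ![lead w f, lead w g] (pderiv 1 T) ≠ 0) (m : ℕ) :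
    ∀ (P Q : MvPolynomial (Fin 2) k) (D : Γ), wdeg ![α, β] P ≤ D →
      weightedHomogeneousComponent ![α, β] D P = T ^ m * Q →
      aeval ![lead w f, lead w g] Q ≠ 0 →
      ∃ γ : Γ, wdeg w (aeval ![f, g] P) = γ ∧ γ ≤ D ∧ D + m • e ≤ γ + m • (α + β) := by
  have hv : ∀ i, wdeg w (![f, g] i) ≤ (![α, β] i : Γ) := by
    intro i
    fin_cases i
    · exact hf.le
    · exact hg.le
  have hv' : (fun i => weightedHomogeneousComponent w (![α, β] i) (![f, g] i)) =
      ![lead w f, lead w g] := by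
    funext i
    fin_cases i
    · exact (lead_eq_component hf).symm
    · exact (lead_eq_component hg).symm
  induction m with
  | zero =>
    intro P Q D hP hc hQ
    obtain ⟨h1, h2⟩ := component_aeval hv hP
    rw [hv', hc, pow_zero, one_mul] at h2
    exact ⟨D, wdeg_eq_of_component_ne_zero h1 (h2 ▸ hQ), le_rfl, by simp⟩
  | succ m ih =>
    intro P Q D hP hc hQ
    have hP' := component_pderiv (1 : Fin 2) hP
    obtain ⟨μ, h1, -, h2⟩ := ih (pderiv 1 P) (((m + 1 : ℕ) : MvPolynomial (Fin 2) k) *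
      pderiv 1 T * Q + T * pderiv 1 Q) _ hP'.1 (by
        rw [hP'.2, hc, Derivation.leibniz, Derivation.leibniz_pow]
        simp only [smul_eq_mul, nsmul_eq_mul, Nat.add_sub_cancel]
        ring) (by
        rw [map_add, map_mul, map_mul, map_mul, hT, zero_mul, add_zero, map_natCast]
        exact mul_ne_zero (mul_ne_zero (Nat.cast_ne_zero.2 (Nat.succ_ne_zero m)) hT') hQ)
    have h3 := he P
    rw [h1] at h3
    have hne : aeval ![f, g] P ≠ 0 := by
      intro h0
      rw [h0, wdeg_zero, WithBot.add_bot, le_bot_iff] at h3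
      exact WithBot.coe_ne_bot (a := μ + e) h3
    obtain ⟨γ, hγ⟩ := exists_wdeg_eq w hne
    refine ⟨γ, hγ, WithBot.coe_le_coe.1 (hγ ▸ (component_aeval hv hP).1), ?_⟩
    rw [hγ] at h3
    have h4 : μ + e ≤ α + γ := by exact_mod_cast h3
    have h5 : (![α, β] 1 : Γ) = β := rfl
    rw [h5] at h2
    rw [succ_nsmul, succ_nsmul]
    generalize m • e = x at *
    generalize m • (α + β) = y at *
    clear * - h2 h4
    grind

/-- The **Shestakov–Umirbaev inequality** for two polynomials. Let `P` be a bivariate polynomial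
of weighted degree `D` for the weights `deg f`, `deg g`. Either `P(f, g)` has degree `D`, its
leading form being obtained by substituting the leading forms, or the leading forms satisfy
`(g ^ w) ^ p = c (f ^ w) ^ q` and then `deg P(f, g)` and `deg (∂P/∂Y)(f, g)` are bounded below as
soon as `p deg g + deg df ∧ dg ≥ deg f + deg g`. -/
theorem wdeg_aeval_dichotomy [CharZero k] (hw : ∀ i, 0 < w i) {e : Γ} (hf : wdeg w f = α)
    (hg : wdeg w g = β) (hα : 0 < α) (hβ : 0 < β)
    (he : ∀ P : MvPolynomial (Fin 2) k,
      wdeg w (aeval ![f, g] (pderiv 1 P)) + e ≤ α + wdeg w (aeval ![f, g] P))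
    {P : MvPolynomial (Fin 2) k} (hP : P ≠ 0) :
    (wdeg w (aeval ![f, g] P) = wdeg ![α, β] P ∧
      lead w (aeval ![f, g] P) = aeval ![lead w f, lead w g] (lead ![α, β] P)) ∨
    ∃ p q : ℕ, 0 < p ∧ 0 < q ∧ Nat.Coprime p q ∧ p • β = q • α ∧
      (∃ c : k, c ≠ 0 ∧ lead w g ^ p = C c * lead w f ^ q) ∧
      ∃ γ μ : Γ, wdeg w (aeval ![f, g] P) = γ ∧ wdeg w (aeval ![f, g] (pderiv 1 P)) = μ ∧
        (α + β ≤ p • β + e → p • β + e ≤ γ + (α + β) ∧ p • β ≤ μ + β) := by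
  have hv : ∀ i, wdeg w (![f, g] i) ≤ (![α, β] i : Γ) := by
    intro i
    fin_cases i
    · exact hf.le
    · exact hg.le
  have hv' : (fun i => weightedHomogeneousComponent w (![α, β] i) (![f, g] i)) =
      ![lead w f, lead w g] := by
    funext i
    fin_cases i
    · exact (lead_eq_component hf).symm
    · exact (lead_eq_component hg).symm
  obtain ⟨D, hD⟩ := exists_wdeg_eq ![α, β] hP
  obtain ⟨h1, h2⟩ := component_aeval hv hD.le
  rw [hv'] at h2
  set H := weightedHomogeneousComponent ![α, β] D P with hH
  by_cases hev : aeval ![lead w f, lead w g] H = 0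
  swap
  · left
    have h3 := wdeg_eq_of_component_ne_zero h1 (h2 ▸ hev)
    exact ⟨h3.trans hD.symm, by rw [lead_eq_component h3, h2, lead_eq_component hD]⟩
  right
  have hH0 : H ≠ 0 := component_ne_zero hD
  have hhom := component_isWeightedHomogeneous ![α, β] D P
  have hdf : wdeg w (lead w f) = α := (wdeg_lead w f).trans hf
  have hdg : wdeg w (lead w g) = β := (wdeg_lead w g).trans hg
  obtain ⟨p, q, hp, hq, hpq, hrel, c, hc, hcrel⟩ :=
    exists_pow_eq hw hα hβ hdf hdg hhom hH0 hev
  refine ⟨p, q, hp, hq, hpq, hrel, ⟨c, hc, hcrel⟩, ?_⟩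
  have hdvd : ∀ {Q : MvPolynomial (Fin 2) k}, aeval ![lead w f, lead w g] Q = 0 →
      binomialRel p q c ∣ Q := by
    refine binomialRel_dvd (w := w) hα hβ ?_ ?_ (ne_zero_of_wdeg_eq hdf)
      (ne_zero_of_wdeg_eq hdg) hp hq hpq hrel hcrel
    · rw [lead_eq_component hf]; exact component_isWeightedHomogeneous _ _ _
    · rw [lead_eq_component hg]; exact component_isWeightedHomogeneous _ _ _
  set T := binomialRel p q c with hTdef
  have hT : aeval ![lead w f, lead w g] T = 0 := by simp [T, binomialRel, hcrel, algebraMap_eq]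
  have hT' : aeval ![lead w f, lead w g] (pderiv 1 T) ≠ 0 := by
    have : pderiv 1 T = (p : MvPolynomial (Fin 2) k) * X 1 ^ (p - 1) := by
      simp [T, binomialRel, Derivation.leibniz, Derivation.leibniz_pow]
    rw [this, map_mul, map_natCast, map_pow, aeval_X]
    exact mul_ne_zero (Nat.cast_ne_zero.2 hp.ne') (pow_ne_zero _ (ne_zero_of_wdeg_eq hdg))
  have hTu : ¬ IsUnit T := fun hu => by
    have := hu.map (aeval (R := k) ![lead w f, lead w g])
    rw [hT] at this
    exact not_isUnit_zero this
  obtain ⟨Q, hQ, hTQ⟩ := (FiniteMultiplicity.of_not_isUnit hTu hH0).exists_eq_pow_mul_and_not_dvd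
  -- The multiplicity is positive since `H` itself is a relation.
  obtain ⟨m, hm⟩ : ∃ m, multiplicity T H = m + 1 := by
    refine Nat.exists_eq_succ_of_ne_zero fun h0 => ?_
    rw [h0, pow_zero, one_mul] at hQ
    exact hTQ (hQ ▸ hdvd hev)
  rw [hm] at hQ
  have hQev : aeval ![lead w f, lead w g] Q ≠ 0 := fun h => hTQ (hdvd h)
  obtain ⟨γ, hγ, -, hγ'⟩ :=
    le_wdeg_aeval_of_component_eq hf hg he hT hT' (m + 1) P Q D hD.le hQ hQev
  have hP' := component_pderiv (1 : Fin 2) hD.le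
  -- The leading form of `∂P/∂Y` is `T ^ m ((m + 1) T' Q + T Q')`, with one factor `T` fewer.
  obtain ⟨μ, hμ, -, hμ'⟩ := le_wdeg_aeval_of_component_eq hf hg he hT hT' m (pderiv 1 P)
    (((m + 1 : ℕ) : MvPolynomial (Fin 2) k) * pderiv 1 T * Q + T * pderiv 1 Q) _ hP'.1 (by
        rw [hP'.2, ← hH, hQ, Derivation.leibniz, Derivation.leibniz_pow]
        simp only [smul_eq_mul, nsmul_eq_mul, Nat.add_sub_cancel]
        ring) (by
        rw [map_add, map_mul, map_mul, map_mul, hT, zero_mul, add_zero, map_natCast]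
        exact mul_ne_zero (mul_ne_zero (Nat.cast_ne_zero.2 (Nat.succ_ne_zero m)) hT') hQev)
  have hDm : (m + 1) • (p • β) ≤ D := by
    have hpos : ∀ i, 0 < (![α, β] : Fin 2 → Γ) i := by
      intro i
      fin_cases i
      · exact hα
      · exact hβ
    have hT0 : T ≠ 0 := by
      intro h
      rw [h, map_zero, map_zero] at hT'
      exact hT' rfl
    have hQ0 : Q ≠ 0 := by
      rintro rfl
      exact hQev (map_zero _)
    have hTd : wdeg ![α, β] T = (p • β : Γ) := by
      refine wdeg_of_isWeightedHomogeneous ?_ hT0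
      have h3 := (isWeightedHomogeneous_X k ![α, β] (1 : Fin 2)).pow p
      have h4 := ((isWeightedHomogeneous_X k ![α, β] (0 : Fin 2)).pow q).C_mul c
      have h5 : q • (![α, β] : Fin 2 → Γ) 0 = p • (![α, β] : Fin 2 → Γ) 1 := hrel.symm
      rw [h5] at h4
      exact h3.sub h4
    obtain ⟨ν, hν⟩ := exists_wdeg_eq ![α, β] hQ0
    have h6 := wdeg_mul_of_eq (wdeg_pow hTd (m + 1)) hν
    rw [← hQ, wdeg_of_isWeightedHomogeneous hhom hH0, WithBot.coe_inj] at h6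
    rw [h6]
    exact le_add_of_nonneg_right (wdeg_nonneg hpos hν)
  refine ⟨γ, μ, hγ, hμ, fun hle => ?_⟩
  have h5 : (![α, β] 1 : Γ) = β := rfl
  rw [h5] at hμ'
  have h7 : m • (α + β) ≤ m • (p • β + e) := nsmul_le_nsmul_right hle m
  rw [nsmul_add (p • β)] at h7
  rw [succ_nsmul] at hDm
  rw [succ_nsmul, succ_nsmul] at hγ'
  generalize m • e = x at *
  generalize m • (α + β) = y at *
  generalize m • (p • β) = z at *
  generalize p • β = u at *
  constructor
  · clear * - h7 hDm hγ' hle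
    grind
  · clear * - h7 hDm hμ' hle
    grind

end Inequality

/-! ### Exterior products of differentials and their degrees -/

section Wedge

variable {k : Type*} [Field k] {n : ℕ}

/-- The exterior product of two differential 1-forms, as a bilinear map. -/
noncomputable def wedge : Ω[MvPolynomial (Fin n) k⁄k] →ₗ[MvPolynomial (Fin n) k]
    Ω[MvPolynomial (Fin n) k⁄k] →ₗ[MvPolynomial (Fin n) k]
      ⋀[MvPolynomial (Fin n) k]^2 (Ω[MvPolynomial (Fin n) k⁄k]) :=
  have swap : ∀ a b : Ω[MvPolynomial (Fin n) k⁄k],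
      exteriorPower.ιMulti (MvPolynomial (Fin n) k) 2 ![a, b] =
        -exteriorPower.ιMulti (MvPolynomial (Fin n) k) 2 ![b, a] := by
    intro a b
    rw [← AlternatingMap.map_swap _ _ (zero_ne_one (α := Fin 2))]
    congr 1
    funext i
    fin_cases i <;> rfl
  LinearMap.mk₂ _ (fun a b => exteriorPower.ιMulti (MvPolynomial (Fin n) k) 2 ![a, b])
    (fun a b c => AlternatingMap.map_vecCons_add _ _ _ _)
    (fun c a b => AlternatingMap.map_vecCons_smul _ _ _ _)
    (fun a b c => by
      rw [swap, swap a b, swap a c, ← neg_add]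
      exact congrArg _ (AlternatingMap.map_vecCons_add _ _ _ _))
    (fun c a b => by
      rw [swap, swap a b, smul_neg]
      exact congrArg _ (AlternatingMap.map_vecCons_smul _ _ _ _))

theorem dWedge_eq_wedge (f g : MvPolynomial (Fin n) k) :
    dWedge f g = wedge (KaehlerDifferential.D k _ f) (KaehlerDifferential.D k _ g) :=
  rfl

@[simp] theorem wedge_self (a : Ω[MvPolynomial (Fin n) k⁄k]) : wedge a a = 0 :=
  AlternatingMap.map_eq_zero_of_eq (exteriorPower.ιMulti (MvPolynomial (Fin n) k) 2) ![a, a]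
    (i := 0) (j := 1) rfl zero_ne_one

theorem wedge_swap (a b : Ω[MvPolynomial (Fin n) k⁄k]) : wedge a b = -wedge b a := by
  have h := wedge_self (a + b)
  simp only [map_add, LinearMap.add_apply, wedge_self, zero_add, add_zero] at h
  exact eq_neg_of_add_eq_zero_right h

theorem dWedge_swap (f g : MvPolynomial (Fin n) k) : dWedge f g = -dWedge g f :=
  wedge_swap _ _

@[simp] theorem D_C (c : k) : KaehlerDifferential.D k (MvPolynomial (Fin n) k) (C c) = 0 :=
  (KaehlerDifferential.D k (MvPolynomial (Fin n) k)).map_algebraMap c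

theorem dWedge_aeval_left (f g : MvPolynomial (Fin n) k) (P : MvPolynomial (Fin 2) k) :
    dWedge f (aeval ![f, g] P) = aeval ![f, g] (pderiv 1 P) • dWedge f g := by
  rw [dWedge_eq_wedge, derivation_aeval, Fin.sum_univ_two, map_add, map_smul, map_smul]
  simp [dWedge_eq_wedge]

theorem dWedge_aeval_right (f g : MvPolynomial (Fin n) k) (P : MvPolynomial (Fin 2) k) :
    dWedge g (aeval ![f, g] P) = -(aeval ![f, g] (pderiv 0 P) • dWedge f g) := by
  rw [dWedge_eq_wedge, derivation_aeval, Fin.sum_univ_two, map_add, map_smul, map_smul,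
    dWedge_swap f g]
  simp [dWedge_eq_wedge]

end Wedge

section FormDegree

variable {k : Type*} [Field k] {Γ : Type*} [AddCommGroup Γ] [LinearOrder Γ] {n l : ℕ}
  {w : Fin n → Γ}

theorem formDeg_le_iff {ω : ⋀[MvPolynomial (Fin n) k]^l (Ω[MvPolynomial (Fin n) k⁄k])}
    {b : WithBot Γ} : formDeg w ω ≤ b ↔ ∀ s : Set.powersetCard (Fin n) l,
      wdeg w (((KaehlerDifferential.mvPolynomialBasis k (Fin n)).exteriorPower l).repr ω s *
        ∏ i ∈ s.1, X i) ≤ b := by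
  simp [formDeg, Finset.sup_le_iff]

@[simp] theorem formDeg_zero :
    formDeg w (0 : ⋀[MvPolynomial (Fin n) k]^l (Ω[MvPolynomial (Fin n) k⁄k])) = ⊥ :=
  le_bot_iff.1 (formDeg_le_iff.2 fun s => by simp)

theorem formDeg_add_le (ω η : ⋀[MvPolynomial (Fin n) k]^l (Ω[MvPolynomial (Fin n) k⁄k])) :
    formDeg w (ω + η) ≤ max (formDeg w ω) (formDeg w η) := by
  refine formDeg_le_iff.2 fun s => ?_
  rw [map_add, Finsupp.add_apply, add_mul]
  exact (wdeg_add_le _ _).trans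
    (max_le_max (formDeg_le_iff.1 le_rfl s) (formDeg_le_iff.1 le_rfl s))

@[simp] theorem formDeg_neg (ω : ⋀[MvPolynomial (Fin n) k]^l (Ω[MvPolynomial (Fin n) k⁄k])) :
    formDeg w (-ω) = formDeg w ω := by
  simp [formDeg]

theorem formDeg_add_eq_left {ω η : ⋀[MvPolynomial (Fin n) k]^l (Ω[MvPolynomial (Fin n) k⁄k])}
    (h : formDeg w η < formDeg w ω) : formDeg w (ω + η) = formDeg w ω := by
  refine le_antisymm ((formDeg_add_le ω η).trans (max_le le_rfl h.le)) ?_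
  by_contra! h'
  have := formDeg_add_le (w := w) (ω + η) (-η)
  rw [add_neg_cancel_right, formDeg_neg] at this
  exact absurd this (not_le.2 (max_lt h' h))

theorem formDeg_dWedge_swap (f g : MvPolynomial (Fin n) k) :
    formDeg w (dWedge f g) = formDeg w (dWedge g f) := by
  rw [dWedge_swap, formDeg_neg]

variable [IsOrderedAddMonoid Γ]

theorem formDeg_smul (p : MvPolynomial (Fin n) k)
    (ω : ⋀[MvPolynomial (Fin n) k]^l (Ω[MvPolynomial (Fin n) k⁄k])) :
    formDeg w (p • ω) = wdeg w p + formDeg w ω := by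
  unfold formDeg
  have h := Finset.apply_sup_eq_sup_comp (s := (Finset.univ : Finset (Set.powersetCard (Fin n) l)))
    (f := fun s => wdeg w
      (((KaehlerDifferential.mvPolynomialBasis k (Fin n)).exteriorPower l).repr ω s *
        ∏ i ∈ s.1, X i)) (fun x => wdeg w p + x)
    (fun x y => (max_add_add_left (wdeg w p) x y).symm) (WithBot.add_bot _)
  rw [h]
  refine Finset.sup_congr rfl fun s _ => ?_
  rw [map_smul, Finsupp.smul_apply, smul_eq_mul, mul_assoc, wdeg_mul]
  rfl

theorem formDeg_pos (hw : ∀ i, 0 < w i) (hl : 0 < l) {e : Γ}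
    {ω : ⋀[MvPolynomial (Fin n) k]^l (Ω[MvPolynomial (Fin n) k⁄k])} (h : formDeg w ω = e) :
    0 < e := by
  by_contra! he
  have h0 : formDeg w ω ≤ ⊥ := by
    refine formDeg_le_iff.2 fun s => ?_
    have hs := formDeg_le_iff.1 h.le s
    rw [wdeg_mul] at hs ⊢
    rcases eq_or_ne (((KaehlerDifferential.mvPolynomialBasis k (Fin n)).exteriorPower l).repr ω s)
      0 with hr | hr
    · simp [hr]
    exfalso
    obtain ⟨ρ, hρ⟩ := exists_wdeg_eq w hr
    have hprod : wdeg w (∏ i ∈ s.1, X i : MvPolynomial (Fin n) k) = (∑ i ∈ s.1, w i : Γ) :=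
      wdeg_of_isWeightedHomogeneous
        (IsWeightedHomogeneous.prod _ _ _ fun i _ => isWeightedHomogeneous_X k w i)
        (Finset.prod_ne_zero_iff.2 fun i _ => X_ne_zero i)
    have hpos : 0 < ∑ i ∈ s.1, w i := by
      refine Finset.sum_pos (fun i _ => hw i) (Finset.card_pos.1 ?_)
      rw [s.2]
      exact hl
    rw [hρ, hprod, ← WithBot.coe_add, WithBot.coe_le_coe] at hs
    exact absurd ((add_pos_of_nonneg_of_pos (wdeg_nonneg hw hρ) hpos).trans_le (hs.trans he))
      (lt_irrefl _)
  rw [h] at h0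
  exact WithBot.coe_ne_bot (le_bot_iff.1 h0)

theorem formDeg_dWedge_le_of_le {f g : MvPolynomial (Fin n) k} {α β : Γ} (hf : wdeg w f ≤ α)
    (hg : wdeg w g ≤ β) : formDeg w (dWedge f g) ≤ (α + β : Γ) := by
  refine formDeg_le_iff.2 fun s => ?_
  set σ := Set.powersetCard.ofFinEmbEquiv.symm s with hσ
  have hprod : (∏ i ∈ s.1, X i : MvPolynomial (Fin n) k) = X (σ 0) * X (σ 1) := by
    have h : s.1 = Finset.univ.map (s.1.orderEmbOfFin s.2).toEmbedding :=
      (Finset.map_orderEmbOfFin_univ s.1 s.2).symm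
    rw [h, Finset.prod_map, Fin.prod_univ_two]
    rfl
  have hterm : ∀ i j, wdeg w (pderiv i f * pderiv j g * (X i * X j)) ≤ (α + β : Γ) := by
    intro i j
    have h1 := wdeg_mul_le_of_le (component_pderiv i hf).1 (wdeg_X (k := k) w i).le
    have h2 := wdeg_mul_le_of_le (component_pderiv j hg).1 (wdeg_X (k := k) w j).le
    rw [sub_add_cancel] at h1 h2
    convert wdeg_mul_le_of_le h1 h2 using 2
    ring
  rw [exteriorPower.basis_repr_apply, dWedge, exteriorPower.ιMultiDual_apply_ιMulti, ← hσ,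
    Matrix.det_fin_two, hprod]
  simp only [Matrix.of_apply, Module.Basis.coord_apply, Matrix.cons_val_zero, Matrix.cons_val_one,
    KaehlerDifferential.mvPolynomialBasis_repr_apply, sub_mul]
  refine (wdeg_sub_le _ _).trans (max_le (hterm _ _) ?_)
  rw [mul_comm (X (σ 0))]
  exact hterm _ _

theorem formDeg_dWedge_le (f g : MvPolynomial (Fin n) k) :
    formDeg w (dWedge f g) ≤ wdeg w f + wdeg w g := by
  rcases eq_or_ne f 0 with rfl | hf
  · simp [dWedge_eq_wedge]
  rcases eq_or_ne g 0 with rfl | hg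
  · simp [dWedge_eq_wedge]
  obtain ⟨α, h⟩ := exists_wdeg_eq w hf
  obtain ⟨β, h'⟩ := exists_wdeg_eq w hg
  rw [h, h', ← WithBot.coe_add]
  exact formDeg_dWedge_le_of_le h.le h'.le

end FormDegree

/-! ### Polynomial expressions in one or two polynomials -/

section Tools

variable {k : Type*} [Field k] {Γ : Type*} [AddCommGroup Γ] [LinearOrder Γ]
  [IsOrderedAddMonoid Γ] {n : ℕ} {w : Fin n → Γ} {f g φ : MvPolynomial (Fin n) k} {α β : Γ}

omit [AddCommGroup Γ] [LinearOrder Γ] [IsOrderedAddMonoid Γ] in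
theorem mem_adjoin_pair_iff {A : Type*} [CommRing A] [Algebra k A] {x y z : A} :
    z ∈ Algebra.adjoin k {x, y} ↔ ∃ P : MvPolynomial (Fin 2) k, aeval ![x, y] P = z := by
  have h : ({x, y} : Set A) = Set.range ![x, y] := by
    simp [Set.pair_comm]
  rw [h, Algebra.adjoin_range_eq_range_aeval]
  rfl

omit [AddCommGroup Γ] [LinearOrder Γ] [IsOrderedAddMonoid Γ] in
theorem mem_adjoin_singleton_iff {A : Type*} [CommRing A] [Algebra k A] {x z : A} :
    z ∈ Algebra.adjoin k {x} ↔ ∃ U : Polynomial k, Polynomial.aeval x U = z := by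
  rw [Algebra.adjoin_singleton_eq_range_aeval]
  rfl

theorem wdeg_polynomial_aeval_le (hf : wdeg w f = α) (hα : 0 < α) {U : Polynomial k} {N : ℕ}
    (hN : U.natDegree ≤ N) : wdeg w (Polynomial.aeval f U) ≤ (N • α : Γ) := by
  rw [Polynomial.aeval_eq_sum_range]
  refine wdeg_sum_le _ _ fun i hi => ?_
  rw [smul_eq_C_mul]
  refine (wdeg_C_mul_le _ _).trans ?_
  rw [wdeg_pow hf i, WithBot.coe_le_coe]
  exact nsmul_le_nsmul_left hα.le ((Finset.mem_range_succ_iff.1 hi).trans hN)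

/-- There is no cancellation in a polynomial expression in one polynomial of positive degree. -/
theorem wdeg_polynomial_aeval (hf : wdeg w f = α) (hα : 0 < α) {U : Polynomial k} (hU : U ≠ 0) :
    wdeg w (Polynomial.aeval f U) = (U.natDegree • α : Γ) ∧
      lead w (Polynomial.aeval f U) = C U.leadingCoeff * lead w f ^ U.natDegree := by
  have hlc := Polynomial.leadingCoeff_ne_zero.2 hU
  have h1 : Polynomial.aeval f U =
      C U.leadingCoeff * f ^ U.natDegree + Polynomial.aeval f U.eraseLead := by
    conv_lhs => rw [← U.eraseLead_add_C_mul_X_pow]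
    rw [map_add, add_comm, map_mul, Polynomial.aeval_C, map_pow, Polynomial.aeval_X]
    rfl
  have h2 : wdeg w (C U.leadingCoeff * f ^ U.natDegree) = (U.natDegree • α : Γ) := by
    rw [wdeg_C_mul hlc, wdeg_pow hf]
  have h3 : wdeg w (Polynomial.aeval f U.eraseLead) <
      wdeg w (C U.leadingCoeff * f ^ U.natDegree) := by
    rw [h2]
    rcases Polynomial.eraseLead_natDegree_lt_or_eraseLead_eq_zero U with h | h
    · exact (wdeg_polynomial_aeval_le hf hα le_rfl).trans_lt
        (WithBot.coe_lt_coe.2 (nsmul_lt_nsmul_left hα h))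
    · rw [h, map_zero, wdeg_zero]
      exact WithBot.bot_lt_coe _
  rw [h1, wdeg_add_eq_left h3, lead_add_eq_left h3, lead_C_mul, lead_pow]
  exact ⟨h2, rfl⟩

/-- A leading form that is a polynomial in another leading form is proportional to a power. -/
theorem exists_pow_of_lead_mem_adjoin (hg : wdeg w g = β) (hβ : 0 < β) (hf : f ≠ 0)
    (h : lead w f ∈ Algebra.adjoin k {lead w g}) :
    ∃ (l : ℕ) (c : k), c ≠ 0 ∧ lead w f = C c * lead w g ^ l ∧ wdeg w f = (l • β : Γ) := by
  obtain ⟨U, hU⟩ := mem_adjoin_singleton_iff.1 h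
  obtain ⟨γ, hγ⟩ := exists_wdeg_eq w hf
  have hU0 : U ≠ 0 := by
    rintro rfl
    exact lead_ne_zero hγ (by rw [← hU, map_zero])
  obtain ⟨h1, h2⟩ := wdeg_polynomial_aeval ((wdeg_lead w g).trans hg) hβ hU0
  rw [hU, lead_lead] at h2
  rw [hU, wdeg_lead] at h1
  exact ⟨_, _, Polynomial.leadingCoeff_ne_zero.2 hU0, h2.trans (by rw [lead_lead]), h1⟩

omit [LinearOrder Γ] [IsOrderedAddMonoid Γ] [AddCommGroup Γ] in
theorem mem_adjoin_of_eq_C_mul_pow {x y : MvPolynomial (Fin n) k} {c : k} {l : ℕ}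
    (h : x = C c * y ^ l) : x ∈ Algebra.adjoin k {y} := by
  rw [h]
  exact mul_mem (Subalgebra.algebraMap_mem _ c) (pow_mem (Algebra.self_mem_adjoin_singleton k y) l)

omit [LinearOrder Γ] [IsOrderedAddMonoid Γ] [AddCommGroup Γ] in
theorem approx_of_eq_C_mul {x y : MvPolynomial (Fin n) k} {c : k} (h : x = C c * y) :
    Approx x y := by
  intro hl
  have := LinearIndependent.pair_iff.1 hl 1 (-c) (by rw [h, ← smul_eq_C_mul]; simp)
  exact one_ne_zero this.1

/-- The differential of `ψ = U(f)` is `U'(f) df`, and `U'(f)` has degree at most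
`deg ψ - deg f`. -/
theorem exists_D_eq_smul_of_mem_adjoin (hf : wdeg w f = α) (hα : 0 < α)
    (hφ : φ ∈ Algebra.adjoin k {f}) {γ : Γ} (hγ : wdeg w φ ≤ γ) :
    ∃ η : MvPolynomial (Fin n) k, KaehlerDifferential.D k _ φ = η • KaehlerDifferential.D k _ f ∧
      wdeg w η ≤ (γ - α : Γ) := by
  obtain ⟨U, rfl⟩ := mem_adjoin_singleton_iff.1 hφ
  refine ⟨Polynomial.aeval f (Polynomial.derivative U), Derivation.map_aeval _ _ _, ?_⟩
  rcases Nat.eq_zero_or_pos U.natDegree with h | h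
  · rw [Polynomial.derivative_of_natDegree_zero h, map_zero, wdeg_zero]
    exact bot_le
  have hU0 : U ≠ 0 := by
    rintro rfl
    simp at h
  rw [(wdeg_polynomial_aeval hf hα hU0).1, WithBot.coe_le_coe] at hγ
  refine (wdeg_polynomial_aeval_le hf hα (Polynomial.natDegree_derivative_le U)).trans
    (WithBot.coe_le_coe.2 (le_sub_iff_add_le.2 ?_))
  rwa [← succ_nsmul, Nat.sub_add_cancel h]

/-- The Shestakov–Umirbaev inequality with `e = deg df ∧ dg`. -/
theorem wdeg_aeval_dichotomy_formDeg [CharZero k] (hw : ∀ i, 0 < w i) {e : Γ}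
    (hf : wdeg w f = α) (hg : wdeg w g = β) (hα : 0 < α) (hβ : 0 < β)
    (he : formDeg w (dWedge f g) = e) {P : MvPolynomial (Fin 2) k} (hP : P ≠ 0) :
    (wdeg w (aeval ![f, g] P) = wdeg ![α, β] P ∧
      lead w (aeval ![f, g] P) = aeval ![lead w f, lead w g] (lead ![α, β] P)) ∨
    ∃ p q : ℕ, 0 < p ∧ 0 < q ∧ Nat.Coprime p q ∧ p • β = q • α ∧
      (∃ c : k, c ≠ 0 ∧ lead w g ^ p = C c * lead w f ^ q) ∧
      ∃ γ μ : Γ, wdeg w (aeval ![f, g] P) = γ ∧ wdeg w (aeval ![f, g] (pderiv 1 P)) = μ ∧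
        (α + β ≤ p • β + e → p • β + e ≤ γ + (α + β) ∧ p • β ≤ μ + β) := by
  refine wdeg_aeval_dichotomy hw hf hg hα hβ (fun P => ?_) hP
  rw [← he, ← formDeg_smul, ← dWedge_aeval_left, ← hf]
  exact formDeg_dWedge_le _ _

/-- If the Shestakov–Umirbaev lower bound exceeds `D`, the polynomial expressions of degree at most
`D` in `f` and `g` involve no cancellation. -/
theorem weight_le_of_wdeg_aeval_le [CharZero k] (hw : ∀ i, 0 < w i) {e D : Γ}
    (hf : wdeg w f = α) (hg : wdeg w g = β) (hα : 0 < α) (hβ : 0 < β)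
    (he : formDeg w (dWedge f g) = e) (hD : 0 ≤ D)
    (hlt : ∀ (p q : ℕ) (c : k), 0 < p → 0 < q → c ≠ 0 → p • β = q • α →
      lead w g ^ p = C c * lead w f ^ q → D + (α + β) < p • β + e)
    {P : MvPolynomial (Fin 2) k} (hP : wdeg w (aeval ![f, g] P) ≤ D) {d : Fin 2 →₀ ℕ}
    (hd : coeff d P ≠ 0) : ((d 0 • α + d 1 • β : Γ) : WithBot Γ) ≤ wdeg w (aeval ![f, g] P) := by
  have hP0 : P ≠ 0 := by
    rintro rfl
    exact hd (coeff_zero d)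
  rcases wdeg_aeval_dichotomy_formDeg hw hf hg hα hβ he hP0 with ⟨h, -⟩ |
    ⟨p, q, hp, hq, -, hrel, ⟨c, hc, hlead⟩, γ, μ, hγ, -, himp⟩
  · rw [h, ← weight_pair]
    exact weight_le_wdeg hd
  · have h1 := hlt p q c hp hq hc hrel hlead
    have h2 := (himp ((le_add_of_nonneg_left hD).trans h1.le)).1
    rw [hγ, WithBot.coe_le_coe] at hP
    have h3 := h1.trans_le h2
    exact absurd (lt_of_add_lt_add_right h3) (not_lt.2 hP)

theorem wdeg_X_mul_pderiv_le (i : Fin n) (f : MvPolynomial (Fin n) k) :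
    wdeg w (X i * pderiv i f) ≤ wdeg w f := by
  rcases eq_or_ne f 0 with rfl | hf
  · simp
  obtain ⟨γ, hγ⟩ := exists_wdeg_eq w hf
  have := wdeg_mul_le_of_le (wdeg_X (k := k) w i).le (component_pderiv i hγ.le).1
  rwa [add_sub_cancel, ← hγ] at this

theorem wdeg_X_mul_pderiv (i : Fin n) (hf : pderiv i (lead w f) ≠ 0) :
    wdeg w (X i * pderiv i f) = wdeg w f := by
  have hf0 : f ≠ 0 := by
    rintro rfl
    exact hf (by simp [lead])
  obtain ⟨γ, hγ⟩ := exists_wdeg_eq w hf0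
  have h1 := component_pderiv i hγ.le
  rw [← lead_eq_component hγ] at h1
  have h2 := wdeg_eq_of_component_ne_zero h1.1 (h1.2 ▸ hf)
  rw [wdeg_mul_of_eq (wdeg_X w i) h2, hγ, add_sub_cancel]

omit [IsOrderedAddMonoid Γ] in
theorem exists_pderiv_ne_zero [CharZero k] (hf : wdeg w f = α) (hα : 0 < α) :
    ∃ i, pderiv i f ≠ 0 := by
  classical
  by_contra! h
  have hC : ∀ d, coeff d f ≠ 0 → d = 0 := by
    intro d hd
    ext i
    by_contra hi
    have h1 := congrArg (coeff (d - Finsupp.single i 1)) (h i)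
    have h2 : d - Finsupp.single i 1 + Finsupp.single i 1 = d :=
      tsub_add_cancel_of_le (Finsupp.single_le_iff.2 (Nat.one_le_iff_ne_zero.2 hi))
    rw [coeff_pderiv, h2, coeff_zero] at h1
    exact (mul_ne_zero hd (Nat.cast_add_one_ne_zero _)) h1
  have : wdeg w f ≤ (0 : Γ) := wdeg_le_iff.2 fun d hd => by rw [hC d hd, map_zero]
  rw [hf, WithBot.coe_le_coe] at this
  exact absurd hα (not_lt.2 this)

/-- Let `(g ^ w) ^ p = c (f ^ w) ^ q` and let `φ = P(f, g)` have degree less than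
`deg (∂P/∂Y)(f, g) + deg g`. Then `deg (∂P/∂X)(f, g) + deg f = deg (∂P/∂Y)(f, g) + deg g`. This is
seen by applying a derivation `xᵢ ∂/∂xᵢ` for which `xᵢ` occurs in `f ^ w` and `g ^ w`. -/
theorem wdeg_aeval_pderiv_add [CharZero k] (hf : wdeg w f = α) (hα : 0 < α) (hg : wdeg w g = β)
    {p q : ℕ} (hq : 0 < q) {c : k} (hc : c ≠ 0)
    (hrel : lead w g ^ p = C c * lead w f ^ q) {P : MvPolynomial (Fin 2) k}
    (hlt : wdeg w (aeval ![f, g] P) < wdeg w (aeval ![f, g] (pderiv 1 P)) + β) :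
    wdeg w (aeval ![f, g] (pderiv 0 P)) + α = wdeg w (aeval ![f, g] (pderiv 1 P)) + β := by
  obtain ⟨i, hi⟩ := exists_pderiv_ne_zero ((wdeg_lead w f).trans hf) hα
  have hi' : pderiv i (lead w g) ≠ 0 := by
    intro h0
    have h1 := congrArg (pderiv i) hrel
    rw [Derivation.leibniz_pow, h0, smul_zero, smul_zero, Derivation.leibniz, pderiv_C, smul_zero,
      add_zero, Derivation.leibniz_pow] at h1
    have hne : (q : MvPolynomial (Fin n) k) ≠ 0 := Nat.cast_ne_zero.2 hq.ne'
    have := lead_ne_zero hf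
    simp [hc, hne, hi, this] at h1
  have hEf := (wdeg_X_mul_pderiv i hi).trans hf
  have hEg := (wdeg_X_mul_pderiv i hi').trans hg
  have hE : X i * pderiv i (aeval ![f, g] P) =
      aeval ![f, g] (pderiv 0 P) * (X i * pderiv i f) +
        aeval ![f, g] (pderiv 1 P) * (X i * pderiv i g) := by
    rw [derivation_aeval, Fin.sum_univ_two]
    simp only [Matrix.cons_val_zero, Matrix.cons_val_one, smul_eq_mul]
    ring
  have h1 : wdeg w (aeval ![f, g] (pderiv 1 P) * (X i * pderiv i g)) =
      wdeg w (aeval ![f, g] (pderiv 1 P)) + β := by rw [wdeg_mul, hEg]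
  have h2 : wdeg w (aeval ![f, g] (pderiv 0 P) * (X i * pderiv i f)) =
      wdeg w (aeval ![f, g] (pderiv 0 P)) + α := by rw [wdeg_mul, hEf]
  rw [← h2, ← h1, eq_sub_of_add_eq hE.symm, ← neg_sub, wdeg_neg, sub_eq_add_neg]
  refine wdeg_add_eq_left ?_
  rw [wdeg_neg, h1]
  exact (wdeg_X_mul_pderiv_le i _).trans_lt hlt

end Tools

/-! ### The degrees attached to a quasi Shestakov–Umirbaev pair -/

section Core

variable {k : Type*} [Field k] {Γ : Type*} [AddCommGroup Γ] [LinearOrder Γ] {n : ℕ}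

/-- The numerical data attached to a pair `(F, G)` satisfying the quasi Shestakov–Umirbaev
condition: the exponent `s` is `2 r + 3`, `e = deg dg₁ ∧ dg₂`, `a₃ = deg f₃` and
`ε = deg df₂ ∧ df₃`. Multiples of `δ` are written as `2 r δ + j δ`, so that all relations between
these degrees are linear in `r δ`, `δ`, `e`, `a₃` and `ε`. -/
structure Core (w : Fin n → Γ) (F G : Fin 3 → MvPolynomial (Fin n) k) (r : ℕ)
    (δ e a₃ ε : Γ) : Prop where
  delta_pos : 0 < δ
  e_pos : 0 < e
  wdeg_g1 : wdeg w (G 0) = (2 • (r • δ) + 3 • δ : Γ)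
  wdeg_g2 : wdeg w (G 1) = (2 • δ : Γ)
  formDeg_g : formDeg w (dWedge (G 0) (G 1)) = e
  lead_g : ∃ c : k, c ≠ 0 ∧ lead w (G 0) ^ 2 = C c * lead w (G 1) ^ (2 * r + 3)
  wdeg_f3 : wdeg w (F 2) = a₃
  le_a₃ : 2 • (r • δ) + δ + e ≤ a₃
  a₃_le : a₃ ≤ 2 • (r • δ) + 3 • δ
  formDeg_f23 : formDeg w (dWedge (F 1) (F 2)) = ε
  formDeg_g1_f3 : formDeg w (dWedge (G 0) (F 2)) = (2 • (r • δ) + δ + ε : Γ)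
  le_ε : 2 • (r • δ) + 3 • δ + e ≤ ε

variable [IsOrderedAddMonoid Γ] {w : Fin n → Γ} {F G : Fin 3 → MvPolynomial (Fin n) k}

theorem nsmul_delta_nonneg {δ : Γ} (h : 0 < δ) (r : ℕ) : 0 ≤ r • δ :=
  nsmul_nonneg h.le r

/-- The relation between `g₁ ^ w` and `g₂ ^ w`, the lower bound for `deg f₃`, and the degrees of
`df₂ ∧ df₃` and `dg₁ ∧ df₃`. The polynomial `φ = f₃ - g₃ = P(g₂, g₁)` has the leading form of
`f₃`, which is not in `k[g₁ ^ w, g₂ ^ w]`; so there is cancellation and the Shestakov–Umirbaev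
inequality applies. -/
theorem QuasiSU.exists_core [CharZero k] (hw : ∀ i, 0 < w i) (hF : AlgebraicIndependent k F)
    (hG : AlgebraicIndependent k G) (h : QuasiSU w F G) :
    ∃ (r : ℕ) (δ e a₃ ε : Γ), Core w F G r δ e a₃ ε := by
  obtain ⟨γ₁, hγ₁⟩ := exists_wdeg_eq w (hG.ne_zero 0)
  obtain ⟨γ₂, hγ₂⟩ := exists_wdeg_eq w (hG.ne_zero 1)
  obtain ⟨γ₃, hγ₃⟩ := exists_wdeg_eq w (hG.ne_zero 2)
  obtain ⟨a₃, ha₃⟩ := exists_wdeg_eq w (hF.ne_zero 2)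
  have h6 := h.su6
  have h5 := h.su5
  have h3 := h.su3_deg
  have h4 := h.su4_deg
  -- If `dg₁ ∧ dg₂` were zero, the right-hand side of the last condition would be `⊥`.
  obtain ⟨e, he⟩ : ∃ e : Γ, formDeg w (dWedge (G 0) (G 1)) = e := by
    obtain ⟨e, he⟩ := WithBot.ne_bot_iff_exists.1
      (show formDeg w (dWedge (G 0) (G 1)) ≠ ⊥ by
        intro h0
        rw [h0, WithBot.add_bot] at h6
        exact not_lt_bot h6)
    exact ⟨e, he.symm⟩
  rw [hγ₁, hγ₂] at h3
  rw [hγ₁, ha₃] at h4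
  rw [hγ₃, ha₃] at h5
  rw [hγ₁, hγ₂, hγ₃, he] at h6
  norm_cast at h3 h4 h5 h6
  have hepos : 0 < e := formDeg_pos hw two_pos he
  -- A constant `g₂` would make `dg₁ ∧ dg₂` vanish.
  have hγ₂pos : 0 < γ₂ := by
    refine lt_of_le_of_ne (wdeg_nonneg hw hγ₂) fun h0 => ?_
    have h1 := eq_C_of_wdeg_le_zero hw (hγ₂.trans (by rw [← h0])).le
    rw [h1, dWedge_eq_wedge, D_C, map_zero, formDeg_zero] at he
    exact WithBot.bot_ne_coe he
  have hγ₁pos : 0 < γ₁ := hγ₂pos.trans h3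
  have he' : formDeg w (dWedge (G 1) (G 0)) = e := by rw [formDeg_dWedge_swap, he]
  have hφmem : F 2 - G 2 ∈ Algebra.adjoin k {G 1, G 0} := by
    rw [Set.pair_comm, ← neg_sub]
    exact neg_mem h.su1_trd
  obtain ⟨P, hP⟩ := mem_adjoin_pair_iff.1 hφmem
  have hlt : wdeg w (-G 2) < wdeg w (F 2) := by
    rw [wdeg_neg, hγ₃, ha₃]
    exact_mod_cast h5
  have hφ : wdeg w (aeval ![G 1, G 0] P) = a₃ := by
    rw [hP, sub_eq_add_neg, wdeg_add_eq_left hlt, ha₃]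
  have hφl : lead w (aeval ![G 1, G 0] P) = lead w (F 2) := by
    rw [hP, sub_eq_add_neg, lead_add_eq_left hlt]
  have hP0 : P ≠ 0 := by
    rintro rfl
    rw [map_zero, wdeg_zero] at hφ
    exact WithBot.bot_ne_coe hφ
  rcases wdeg_aeval_dichotomy_formDeg hw hγ₂ hγ₁ hγ₂pos hγ₁pos he' hP0 with ⟨-, h1⟩ |
    ⟨p, q, hp, hq, hpq, hrel, ⟨c, hc, hlead⟩, γ, μ, hγ, hμ, himp⟩
  · refine absurd ?_ h.su4_lead
    rw [← hφl, h1, Set.pair_comm]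
    exact mem_adjoin_pair_iff.2 ⟨_, rfl⟩
  obtain rfl : γ = a₃ := WithBot.coe_injective (hγ.symm.trans hφ)
  have hp1 : p ≠ 1 := by
    rintro rfl
    rw [pow_one] at hlead
    exact h.su3_lead (mem_adjoin_of_eq_C_mul_pow hlead)
  have hp2 : 2 • γ₁ ≤ p • γ₁ := nsmul_le_nsmul_left hγ₁pos.le (by omega)
  obtain ⟨hi1, hi2⟩ := himp (by clear * - hp2 hepos h3; grind)
  -- For `p ≥ 3` the lower bound for `deg f₃` exceeds `deg g₁`.
  obtain rfl : p = 2 := by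
    by_contra hne
    have hp3 : 3 • γ₁ ≤ p • γ₁ := nsmul_le_nsmul_left hγ₁pos.le (by omega)
    clear * - hp3 hi1 h4 h3 hepos
    grind
  obtain ⟨t, rfl⟩ : Odd q := Nat.coprime_two_left.1 hpq
  obtain ⟨r, rfl⟩ : ∃ r, t = r + 1 := by
    refine Nat.exists_eq_succ_of_ne_zero ?_
    rintro rfl
    rw [mul_zero, zero_add, one_nsmul] at hrel
    clear * - hrel h3 hγ₂pos
    grind
  -- From `2 γ₁ = (2 r + 3) γ₂`, half of `γ₂` is `γ₁ - (r + 1) γ₂`.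
  set δ := γ₁ - (r + 1) • γ₂ with hδ
  have hδ2 : γ₂ = 2 • δ := by
    have h7 : (2 * (r + 1) + 1) • γ₂ = 2 • (r • γ₂) + 3 • γ₂ := by
      rw [← mul_nsmul', ← add_nsmul]; congr 1
    rw [h7] at hrel
    rw [succ_nsmul] at hδ
    clear * - hrel hδ
    grind
  have hδ1 : γ₁ = 2 • (r • δ) + 3 • δ := by
    have h7 : γ₁ = δ + (r + 1) • γ₂ := by rw [hδ]; abel
    have h8 : (r + 1) • (2 • δ) = 2 • (r • δ) + 2 • δ := by
      rw [← mul_nsmul', ← mul_nsmul', ← add_nsmul]; congr 1; ring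
    rw [hδ2, h8] at h7
    clear * - h7
    grind
  have hδpos : 0 < δ := by clear * - hδ2 hγ₂pos; grind
  have hrδ := nsmul_delta_nonneg hδpos r
  clear_value δ
  -- As `g₂ - f₂` lies in `k[f₃]`, the forms `df₂ ∧ df₃` and `dg₂ ∧ df₃` agree; the contribution of
  -- `g₃` to the latter is negligible.
  obtain ⟨U, hU⟩ := mem_adjoin_singleton_iff.1 h.su1_snd
  have hG2 : F 1 = G 1 - Polynomial.aeval (F 2) U := by rw [hU]; abel
  have hF3 : F 2 = aeval ![G 1, G 0] P + G 2 := by rw [hP]; abel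
  have hw23 : dWedge (F 1) (F 2) = dWedge (G 1) (F 2) := by
    rw [dWedge_eq_wedge, hG2, map_sub, Derivation.map_aeval, map_sub, map_smul]
    simp [dWedge_eq_wedge]
  have hsplit : ∀ x : MvPolynomial (Fin n) k,
      dWedge x (F 2) = dWedge x (aeval ![G 1, G 0] P) + dWedge x (G 2) := by
    intro x
    rw [hF3]
    simp [dWedge_eq_wedge]
  have hf2 : formDeg w (dWedge (G 1) (F 2)) = (μ + e : Γ) := by
    have h7 : formDeg w (dWedge (G 1) (aeval ![G 1, G 0] P)) = (μ + e : Γ) := by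
      rw [dWedge_aeval_left, formDeg_smul, hμ, he', WithBot.coe_add]
    rw [hsplit, formDeg_add_eq_left, h7]
    rw [h7]
    refine (formDeg_dWedge_le_of_le hγ₂.le hγ₃.le).trans_lt (WithBot.coe_lt_coe.2 ?_)
    clear * - h6 hi2
    grind
  obtain ⟨ν, hν, hν'⟩ : ∃ ν : Γ, wdeg w (aeval ![G 1, G 0] (pderiv 0 P)) = ν ∧
      ν + γ₂ = μ + γ₁ := by
    have h7 := wdeg_aeval_pderiv_add hγ₂ hγ₂pos hγ₁ hq hc hlead (P := P) (by
      rw [hφ, hμ, ← WithBot.coe_add, WithBot.coe_lt_coe]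
      clear * - hi2 h4 hγ₁pos
      grind)
    rw [hμ] at h7
    have hne : aeval ![G 1, G 0] (pderiv 0 P) ≠ 0 := by
      intro h0
      rw [h0, wdeg_zero, WithBot.bot_add] at h7
      exact WithBot.bot_ne_coe (a := μ + γ₁) h7
    obtain ⟨ν, hν⟩ := exists_wdeg_eq w hne
    rw [hν] at h7
    exact ⟨ν, hν, by exact_mod_cast h7⟩
  have hf1 : formDeg w (dWedge (G 0) (F 2)) = (ν + e : Γ) := by
    have h7 : formDeg w (dWedge (G 0) (aeval ![G 1, G 0] P)) = (ν + e : Γ) := by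
      rw [dWedge_aeval_right, formDeg_neg, formDeg_smul, hν, he', WithBot.coe_add]
    rw [hsplit, formDeg_add_eq_left, h7]
    rw [h7]
    refine (formDeg_dWedge_le_of_le hγ₁.le hγ₃.le).trans_lt (WithBot.coe_lt_coe.2 ?_)
    clear * - h6 hi2 hν'
    grind
  refine ⟨r, δ, e, γ, μ + e, hδpos, hepos, by rw [hγ₁, hδ1], by rw [hγ₂, hδ2], he,
    ⟨c, hc, hlead⟩, ha₃, ?_, ?_, by rw [hw23, hf2], ?_, ?_⟩
  · clear * - hi1 hδ1 hδ2
    generalize r • δ = ρ at *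
    grind
  · rwa [← hδ1]
  · rw [hf1, WithBot.coe_inj]
    clear * - hν' hδ1 hδ2
    generalize r • δ = ρ at *
    grind
  · clear * - hi2 hδ1
    generalize r • δ = ρ at *
    grind

end Core

/-! ### Expressions in `f₂` and `f₃` -/

section Expansion

variable {k : Type*} [Field k] {Γ : Type*} [AddCommGroup Γ] [LinearOrder Γ]
  [IsOrderedAddMonoid Γ] {n : ℕ} {w : Fin n → Γ} {F G : Fin 3 → MvPolynomial (Fin n) k} {r : ℕ}
  {δ e a₃ ε : Γ}

theorem le_of_nsmul_le_nsmul {δ : Γ} (hδ : 0 < δ) {i j : ℕ} (h : i • δ ≤ j • δ) : i ≤ j := by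
  by_contra! hlt
  exact absurd (nsmul_lt_nsmul_left hδ hlt) (not_lt.2 h)

theorem delta_le_nsmul {δ : Γ} (hδ : 0 < δ) {r : ℕ} (hr : r ≠ 0) : δ ≤ r • δ := by
  simpa using nsmul_le_nsmul_left hδ.le (Nat.one_le_iff_ne_zero.2 hr)

/-- An even multiple of `δ` that is at most `(2 r + 3) δ` is at most `(2 r + 2) δ`. -/
theorem nsmul_two_nsmul_le {δ : Γ} (hδ : 0 < δ) {i r : ℕ}
    (h : i • (2 • δ) ≤ 2 • (r • δ) + 3 • δ) : i • (2 • δ) ≤ 2 • (r • δ) + 2 • δ := by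
  rw [← mul_nsmul', ← mul_nsmul', ← add_nsmul] at h ⊢
  have := le_of_nsmul_le_nsmul hδ h
  exact nsmul_le_nsmul_left hδ.le (by omega)

/-- A bivariate polynomial expression without the second variable. -/
theorem aeval_mem_adjoin_left {x y : MvPolynomial (Fin n) k} {α : Γ} (hx : wdeg w x = α)
    {Q : MvPolynomial (Fin 2) k} {B : WithBot Γ}
    (hQ : ∀ d, coeff d Q ≠ 0 → d 1 = 0 ∧ ((d 0 • α : Γ) : WithBot Γ) ≤ B) :
    aeval ![x, y] Q ∈ Algebra.adjoin k {x} ∧ wdeg w (aeval ![x, y] Q) ≤ B := by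
  have h : aeval ![x, y] Q = ∑ d ∈ Q.support, C (coeff d Q) * x ^ d 0 := by
    conv_lhs => rw [Q.as_sum, map_sum]
    refine Finset.sum_congr rfl fun d hd => ?_
    rw [aeval_monomial, Finsupp.prod_fintype _ _ (by simp), Fin.prod_univ_two,
      (hQ d (mem_support_iff.1 hd)).1]
    simp [algebraMap_eq]
  rw [h]
  refine ⟨sum_mem fun d _ => mem_adjoin_of_eq_C_mul_pow rfl, wdeg_sum_le _ _ fun d hd => ?_⟩
  refine (wdeg_C_mul_le _ _).trans ?_
  rw [wdeg_pow hx]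
  exact (hQ d (mem_support_iff.1 hd)).2

namespace Core

/-- Elements of `k[f₃]` of degree at most `2 δ` are affine in `f₃`, since `deg f₃ > δ`. -/
theorem exists_affine (h : Core w F G r δ e a₃ ε) {φ : MvPolynomial (Fin n) k}
    (hφ : φ ∈ Algebra.adjoin k {F 2}) (hle : wdeg w φ ≤ (2 • δ : Γ)) :
    ∃ b d : k, φ = C b * F 2 + C d ∧ (b ≠ 0 → a₃ ≤ 2 • δ) := by
  obtain ⟨U, rfl⟩ := mem_adjoin_singleton_iff.1 hφ
  have hδ := h.delta_pos
  have hr := nsmul_delta_nonneg hδ r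
  have ha := h.le_a₃
  have he := h.e_pos
  have ha0 : 0 < a₃ := by
    clear * - hδ hr ha he
    generalize r • δ = ρ at *
    grind
  have hN : U ≠ 0 → U.natDegree • a₃ ≤ 2 • δ := fun hU => by
    rwa [(wdeg_polynomial_aeval h.wdeg_f3 ha0 hU).1, WithBot.coe_le_coe] at hle
  have hU1 : U.natDegree ≤ 1 := by
    by_contra! h2
    have hU : U ≠ 0 := by
      rintro rfl
      simp at h2
    have h3 : 2 • a₃ ≤ U.natDegree • a₃ := nsmul_le_nsmul_left ha0.le h2
    have h4 := h3.trans (hN hU)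
    clear * - h4 hδ hr ha he
    generalize r • δ = ρ at *
    grind
  obtain ⟨b, d, hbd⟩ := Polynomial.exists_eq_X_add_C_of_natDegree_le_one hU1
  refine ⟨b, d, ?_, fun hb => ?_⟩
  · rw [hbd]
    simp [algebraMap_eq]
  · have hU : U ≠ 0 := by
      rintro rfl
      have := congrArg (Polynomial.coeff · 1) hbd
      simp at this
      exact hb this.symm
    have h1 : U.natDegree = 1 := by rw [hbd]; exact Polynomial.natDegree_linear hb
    simpa [h1] using hN hU

/-- The polynomials `f₂` and `g₂` have the same degree and differ by an affine expression in `f₃`: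
otherwise `g₂ ^ w` would be proportional to `f₃ ^ w`. -/
theorem wdeg_f2_and_exists_g2 (h : Core w F G r δ e a₃ ε) (hQ : QuasiSU w F G) :
    wdeg w (F 1) = (2 • δ : Γ) ∧
      ∃ b d : k, G 1 = F 1 + C b * F 2 + C d ∧ (b ≠ 0 → a₃ ≤ 2 • δ) := by
  have hle : wdeg w (F 1) ≤ (2 • δ : Γ) := h.wdeg_g2 ▸ hQ.su2_snd
  obtain ⟨b, d, hbd, hb⟩ := h.exists_affine hQ.su1_snd
    ((wdeg_sub_le _ _).trans (max_le h.wdeg_g2.le hle))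
  have hG : G 1 = F 1 + C b * F 2 + C d := by rw [add_assoc, ← hbd]; ring
  refine ⟨le_antisymm hle ?_, b, d, hG, hb⟩
  by_contra! hlt
  have hδ := h.delta_pos
  have h2δ : 0 < 2 • δ := by clear * - hδ; grind
  have hd : wdeg w (C d : MvPolynomial (Fin n) k) < (2 • δ : Γ) :=
    (wdeg_C_le w d).trans_lt (WithBot.coe_lt_coe.2 h2δ)
  have hcomp : lead w (G 1) = C b * weightedHomogeneousComponent w (2 • δ) (F 2) := by
    rw [lead_eq_component h.wdeg_g2, hG, map_add, map_add, component_eq_zero_of_wdeg_lt hlt,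
      component_eq_zero_of_wdeg_lt hd, weightedHomogeneousComponent_C_mul, zero_add, add_zero]
  have hne := lead_ne_zero h.wdeg_g2
  rw [hcomp] at hne
  have hb0 : b ≠ 0 := by
    rintro rfl
    simp at hne
  have ha : a₃ = 2 • δ := by
    refine le_antisymm (hb hb0) ?_
    rw [← WithBot.coe_le_coe, ← h.wdeg_f3]
    exact le_wdeg_of_component_ne_zero (right_ne_zero_of_mul hne)
  rw [← ha, ← lead_eq_component h.wdeg_f3] at hcomp
  have hl : lead w (F 2) = C b⁻¹ * lead w (G 1) := by
    rw [hcomp, ← mul_assoc, ← C_mul, inv_mul_cancel₀ hb0, C_1, one_mul]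
  refine hQ.su4_lead ?_
  rw [hl]
  exact mul_mem (Subalgebra.algebraMap_mem _ _) (Algebra.subset_adjoin (by simp))

theorem lead_f3_ne_C_mul_lead_f2 (h : Core w F G r δ e a₃ ε) (hQ : QuasiSU w F G) (c : k) :
    lead w (F 2) ≠ C c * lead w (F 1) := by
  intro hl
  obtain ⟨hf2, b, d, hG, -⟩ := h.wdeg_f2_and_exists_g2 hQ
  have hδ := h.delta_pos
  have h2δ : 0 < 2 • δ := by clear * - hδ; grind
  have hd : wdeg w (C d : MvPolynomial (Fin n) k) < (2 • δ : Γ) :=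
    (wdeg_C_le w d).trans_lt (WithBot.coe_lt_coe.2 h2δ)
  have hc : c ≠ 0 := by
    rintro rfl
    exact lead_ne_zero h.wdeg_f3 (by simpa using hl)
  have ha : a₃ = 2 • δ := by
    have := congrArg (wdeg w) hl
    rw [wdeg_C_mul hc, wdeg_lead, wdeg_lead, h.wdeg_f3, hf2] at this
    exact WithBot.coe_injective this
  have hcomp : lead w (G 1) = C (1 + b * c) * lead w (F 1) := by
    rw [lead_eq_component h.wdeg_g2, hG, map_add, map_add, component_eq_zero_of_wdeg_lt hd,
      weightedHomogeneousComponent_C_mul, ← lead_eq_component hf2, ← ha,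
      ← lead_eq_component h.wdeg_f3, hl, C_add, C_mul, C_1]
    ring
  have hne := lead_ne_zero h.wdeg_g2
  rw [hcomp] at hne
  have hbc : 1 + b * c ≠ 0 := by
    intro h0
    simp [h0] at hne
  have hl' : lead w (F 2) = C (c * (1 + b * c)⁻¹) * lead w (G 1) := by
    rw [hcomp, hl, ← mul_assoc, ← C_mul, mul_assoc, inv_mul_cancel₀ hbc, mul_one]
  refine hQ.su4_lead ?_
  rw [hl']
  exact mul_mem (Subalgebra.algebraMap_mem _ _) (Algebra.subset_adjoin (by simp))

theorem lead_f3_notMem (h : Core w F G r δ e a₃ ε) (hQ : QuasiSU w F G) :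
    lead w (F 2) ∉ Algebra.adjoin k {lead w (F 1)} := by
  intro hmem
  obtain ⟨hf2, b, d, hG, hb⟩ := h.wdeg_f2_and_exists_g2 hQ
  have hδ := h.delta_pos
  have hr := nsmul_delta_nonneg hδ r
  have hle := h.le_a₃
  have he := h.e_pos
  have h2δ : 0 < 2 • δ := by clear * - hδ; grind
  obtain ⟨l, c, hc, hl, hdeg⟩ := exists_pow_of_lead_mem_adjoin hf2 h2δ
    (ne_zero_of_wdeg_eq h.wdeg_f3) hmem
  rw [h.wdeg_f3, WithBot.coe_inj] at hdeg
  have hl2 : 2 ≤ l := by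
    by_contra! hlt
    interval_cases l
    · rw [zero_nsmul] at hdeg
      clear * - hδ hr hle he hdeg
      generalize r • δ = ρ at *
      grind
    · rw [pow_one] at hl
      exact h.lead_f3_ne_C_mul_lead_f2 hQ c hl
  have h4 : 2 • (2 • δ) ≤ a₃ := hdeg ▸ nsmul_le_nsmul_left h2δ.le hl2
  have hb0 : b = 0 := by
    by_contra hb0
    have := hb hb0
    clear * - this h4 hδ
    grind
  have hlead : lead w (G 1) = lead w (F 1) := by
    rw [hG, hb0, C_0, zero_mul, add_zero]
    refine lead_add_eq_left ?_
    rw [hf2]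
    exact (wdeg_C_le w d).trans_lt (WithBot.coe_lt_coe.2 h2δ)
  refine hQ.su4_lead (Algebra.adjoin_mono ?_ (hlead ▸ hmem))
  simp

theorem lead_f2_notMem (h : Core w F G r δ e a₃ ε) (hQ : QuasiSU w F G) :
    lead w (F 1) ∉ Algebra.adjoin k {lead w (F 2)} := by
  intro hmem
  obtain ⟨hf2, -⟩ := h.wdeg_f2_and_exists_g2 hQ
  have hδ := h.delta_pos
  have hr := nsmul_delta_nonneg hδ r
  have hle := h.le_a₃
  have he := h.e_pos
  have ha0 : 0 < a₃ := by
    clear * - hδ hr hle he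
    generalize r • δ = ρ at *
    grind
  obtain ⟨l, c, hc, hl, hdeg⟩ := exists_pow_of_lead_mem_adjoin h.wdeg_f3 ha0
    (ne_zero_of_wdeg_eq hf2) hmem
  rw [hf2, WithBot.coe_inj] at hdeg
  have hl1 : l = 1 := by
    by_contra hne
    rcases Nat.lt_or_ge l 2 with hlt | hge
    · obtain rfl : l = 0 := by omega
      rw [zero_nsmul] at hdeg
      clear * - hδ hdeg
      grind
    · have h3 : 2 • a₃ ≤ l • a₃ := nsmul_le_nsmul_left ha0.le hge
      rw [← hdeg] at h3
      clear * - hδ hr hle he h3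
      generalize r • δ = ρ at *
      grind
  rw [hl1, pow_one] at hl
  refine h.lead_f3_ne_C_mul_lead_f2 hQ c⁻¹ ?_
  rw [hl, ← mul_assoc, ← C_mul, inv_mul_cancel₀ hc, C_1, one_mul]

/-- There is no cancellation in expressions of `f₂` and `f₃` of degree at most
`s δ`, and degree reasons leave only few monomials. -/
theorem exists_quadratic [CharZero k] (hw : ∀ i, 0 < w i) (h : Core w F G r δ e a₃ ε)
    (hQ : QuasiSU w F G) {φ : MvPolynomial (Fin n) k}
    (hφ : φ ∈ Algebra.adjoin k {F 1, F 2}) (hle : wdeg w φ ≤ wdeg w (G 0)) :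
    ∃ a c : k, ∃ ψ ∈ Algebra.adjoin k {F 1}, wdeg w ψ ≤ (2 • (r • δ) + 2 • δ : Γ) ∧
      φ = C a * F 2 ^ 2 + C c * F 2 + ψ ∧ (a ≠ 0 → 2 • a₃ ≤ 2 • (r • δ) + 3 • δ) := by
  classical
  obtain ⟨P, rfl⟩ := mem_adjoin_pair_iff.1 hφ
  obtain ⟨hf2, -⟩ := h.wdeg_f2_and_exists_g2 hQ
  have hδ := h.delta_pos
  have hr := nsmul_delta_nonneg hδ r
  have ha := h.le_a₃
  have he := h.e_pos
  have hε := h.le_ε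
  have h2δ : 0 < 2 • δ := by clear * - hδ; grind
  have ha0 : 0 < a₃ := by
    clear * - hδ hr ha he
    generalize r • δ = ρ at *
    grind
  rw [h.wdeg_g1] at hle
  have hwt : ∀ {d : Fin 2 →₀ ℕ}, coeff d P ≠ 0 →
      d 0 • (2 • δ) + d 1 • a₃ ≤ 2 • (r • δ) + 3 • δ := by
    intro d hd
    rw [← WithBot.coe_le_coe]
    refine (weight_le_of_wdeg_aeval_le hw hf2 h.wdeg_f3 h2δ ha0 h.formDeg_f23
      (D := 2 • (r • δ) + 3 • δ) ?_ ?_ hle hd).trans hle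
    · clear * - hδ hr
      generalize r • δ = ρ at *
      grind
    · intro p q c hp hq hc hrel hl
      have hp2 : 2 ≤ p := by
        by_contra! hlt
        obtain rfl : p = 1 := by omega
        rw [pow_one] at hl
        exact h.lead_f3_notMem hQ (mem_adjoin_of_eq_C_mul_pow hl)
      have hq2 : 2 ≤ q := by
        by_contra! hlt
        obtain rfl : q = 1 := by omega
        rw [pow_one] at hl
        refine h.lead_f2_notMem hQ (mem_adjoin_of_eq_C_mul_pow (c := c⁻¹) (l := p) ?_)
        rw [hl, ← mul_assoc, ← C_mul, inv_mul_cancel₀ hc, C_1, one_mul]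
      have h1 : 2 • a₃ ≤ p • a₃ := nsmul_le_nsmul_left ha0.le hp2
      have h2 : 2 • (2 • δ) ≤ q • (2 • δ) := nsmul_le_nsmul_left h2δ.le hq2
      rw [← hrel] at h2
      clear * - h1 h2 hε he
      generalize r • δ = ρ at *
      generalize p • a₃ = u at *
      grind
  have hd1 : ∀ {d : Fin 2 →₀ ℕ}, coeff d P ≠ 0 → d 1 ≤ 2 ∧ (d 1 ≠ 0 → d 0 = 0) := by
    intro d hd
    have h1 := hwt hd
    have h2 : 0 ≤ d 0 • (2 • δ) := nsmul_nonneg h2δ.le _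
    constructor
    · by_contra! h3
      have h4 : 3 • a₃ ≤ d 1 • a₃ := nsmul_le_nsmul_left ha0.le h3
      clear * - h1 h2 h4 ha hr he
      generalize r • δ = ρ at *
      generalize d 0 • (2 • δ) = u at *
      generalize d 1 • a₃ = v at *
      grind
    · intro h3
      by_contra h4
      have h5 : 2 • δ ≤ d 0 • (2 • δ) := delta_le_nsmul h2δ h4
      have h6 : a₃ ≤ d 1 • a₃ := delta_le_nsmul ha0 h3
      clear * - h1 h5 h6 ha he
      generalize r • δ = ρ at *
      generalize d 0 • (2 • δ) = u at *
      generalize d 1 • a₃ = v at *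
      grind
  set a := coeff (Finsupp.single 1 2) P with ha_def
  set c := coeff (Finsupp.single 1 1) P with hc_def
  set Q := P - monomial (Finsupp.single 1 2) a - monomial (Finsupp.single 1 1) c with hQ_def
  have hQP : ∀ d, coeff d Q ≠ 0 → d 1 = 0 ∧ coeff d P ≠ 0 := by
    intro d hd
    rw [hQ_def, coeff_sub, coeff_sub, coeff_monomial, coeff_monomial] at hd
    have hne2 : Finsupp.single 1 2 ≠ d := by
      rintro rfl
      have : Finsupp.single (1 : Fin 2) 1 ≠ Finsupp.single (1 : Fin 2) 2 := fun h0 => by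
        have := congrArg (· 1) h0
        simp at this
      rw [if_pos rfl, if_neg this, ← ha_def] at hd
      simp at hd
    have hne1 : Finsupp.single 1 1 ≠ d := by
      rintro rfl
      rw [if_pos rfl, if_neg hne2, ← hc_def] at hd
      simp at hd
    rw [if_neg hne1, if_neg hne2, sub_zero, sub_zero] at hd
    refine ⟨?_, hd⟩
    by_contra h1
    have h2 := hd1 hd
    have h3 := h2.2 h1
    have h4 : d 1 = 1 ∨ d 1 = 2 := by omega
    rcases h4 with h4 | h4
    · exact hne1 (pair_ext (by simp [h3]) (by simp [h4]))
    · exact hne2 (pair_ext (by simp [h3]) (by simp [h4]))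
  obtain ⟨hmem, hdeg⟩ := aeval_mem_adjoin_left (w := w) (y := F 2) hf2 (Q := Q)
    (B := (2 • (r • δ) + 2 • δ : Γ)) fun d hd => by
      obtain ⟨h1, h2⟩ := hQP d hd
      refine ⟨h1, WithBot.coe_le_coe.2 (nsmul_two_nsmul_le hδ ?_)⟩
      have := hwt h2
      rwa [h1, zero_nsmul, add_zero] at this
  refine ⟨a, c, _, hmem, hdeg, ?_, fun h0 => ?_⟩
  · rw [hQ_def, map_sub, map_sub, aeval_monomial, aeval_monomial,
      Finsupp.prod_single_index (by simp), Finsupp.prod_single_index (by simp)]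
    simp [algebraMap_eq]
  · have := hwt h0
    simpa using this

end Core
end Expansion

/-! ### The shape of `(F, G)` and the degrees of `df₁ ∧ df₂`, `df₁ ∧ df₃` -/

section Conclusions

variable {k : Type*} [Field k] {Γ : Type*} [AddCommGroup Γ] [LinearOrder Γ] {n : ℕ}

/-- The data of `Core` together with the expressions of `g₁` and `g₂` through `F`; here
`dψ = η df₂`. -/
structure Expansion (w : Fin n → Γ) (F G : Fin 3 → MvPolynomial (Fin n) k) (r : ℕ)
    (δ e a₃ ε : Γ) (a b c d : k) (ψ η : MvPolynomial (Fin n) k) : Prop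
    extends Core w F G r δ e a₃ ε where
  wdeg_f2 : wdeg w (F 1) = (2 • δ : Γ)
  g1_eq : G 0 = F 0 + C a * F 2 ^ 2 + C c * F 2 + ψ
  g2_eq : G 1 = F 1 + C b * F 2 + C d
  of_a_ne_zero : a ≠ 0 → 2 • a₃ ≤ 2 • (r • δ) + 3 • δ
  of_b_ne_zero : b ≠ 0 → a₃ ≤ 2 • δ
  psi_mem : ψ ∈ Algebra.adjoin k {F 1}
  wdeg_psi : wdeg w ψ ≤ (2 • (r • δ) + 2 • δ : Γ)
  D_psi : KaehlerDifferential.D k _ ψ = η • KaehlerDifferential.D k _ (F 1)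
  wdeg_eta : wdeg w η ≤ (2 • (r • δ) : Γ)

variable [IsOrderedAddMonoid Γ] {w : Fin n → Γ} {F G : Fin 3 → MvPolynomial (Fin n) k} {r : ℕ}
  {δ e a₃ ε : Γ} {a b c d : k} {ψ η : MvPolynomial (Fin n) k}

theorem Core.exists_expansion [CharZero k] (hw : ∀ i, 0 < w i) (h : Core w F G r δ e a₃ ε)
    (hQ : QuasiSU w F G) : ∃ (a b c d : k) (ψ η : MvPolynomial (Fin n) k),
      Expansion w F G r δ e a₃ ε a b c d ψ η := by
  obtain ⟨hf2, b, d, hG, hb⟩ := h.wdeg_f2_and_exists_g2 hQ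
  obtain ⟨a, c, ψ, hψ, hψd, heq, ha⟩ := h.exists_quadratic hw hQ hQ.su1_fst
    ((wdeg_sub_le _ _).trans (max_le le_rfl hQ.su2_fst))
  have hδ := h.delta_pos
  have h2δ : 0 < 2 • δ := by clear * - hδ; grind
  obtain ⟨η, hη, hηd⟩ := exists_D_eq_smul_of_mem_adjoin hf2 h2δ hψ hψd
  rw [add_sub_cancel_right] at hηd
  refine ⟨a, b, c, d, ψ, η, { h with
    wdeg_f2 := hf2, g1_eq := ?_, g2_eq := hG, of_a_ne_zero := ha, of_b_ne_zero := hb,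
    psi_mem := hψ, wdeg_psi := hψd, D_psi := hη, wdeg_eta := hηd }⟩
  rw [add_assoc, add_assoc, ← add_assoc (C a * _), ← heq]
  ring

omit [AddCommGroup Γ] [LinearOrder Γ] [IsOrderedAddMonoid Γ] in
theorem D_g1_eq {f₁ f₂ f₃ g₁ : MvPolynomial (Fin n) k}
    (hg₁ : g₁ = f₁ + C a * f₃ ^ 2 + C c * f₃ + ψ)
    (hψ : KaehlerDifferential.D k _ ψ = η • KaehlerDifferential.D k _ f₂) :
    KaehlerDifferential.D k _ g₁ = KaehlerDifferential.D k _ f₁ +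
      (C (2 * a) * f₃ + C c) • KaehlerDifferential.D k _ f₃ +
        η • KaehlerDifferential.D k _ f₂ := by
  rw [hg₁, map_add, map_add, map_add, hψ, Derivation.leibniz, Derivation.leibniz,
    Derivation.leibniz_pow, D_C, D_C, C_mul, (map_ofNat C 2 : C (2 : k) = 2)]
  simp only [Nat.add_one_sub_one, pow_one]
  module

omit [AddCommGroup Γ] [LinearOrder Γ] [IsOrderedAddMonoid Γ] in
/-- Expansion of `dg₁ ∧ dg₂` in terms of `df₁ ∧ df₂`, `df₁ ∧ df₃` and `df₂ ∧ df₃`. -/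
theorem dWedge_eq_of_expansion {f₁ f₂ f₃ g₁ g₂ : MvPolynomial (Fin n) k}
    (hg₁ : g₁ = f₁ + C a * f₃ ^ 2 + C c * f₃ + ψ) (hg₂ : g₂ = f₂ + C b * f₃ + C d)
    (hψ : KaehlerDifferential.D k _ ψ = η • KaehlerDifferential.D k _ f₂) :
    dWedge g₁ g₂ = dWedge f₁ f₂ + (C b : MvPolynomial (Fin n) k) • dWedge f₁ f₃ -
      (C (2 * a) * f₃ + C c - C b * η) • dWedge f₂ f₃ := by
  have h₂ : KaehlerDifferential.D k _ g₂ =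
      KaehlerDifferential.D k _ f₂ + (C b : MvPolynomial (Fin n) k) •
        KaehlerDifferential.D k _ f₃ := by
    rw [hg₂, map_add, map_add, Derivation.leibniz, D_C, D_C]
    module
  simp only [dWedge_eq_wedge, D_g1_eq hg₁ hψ, h₂, map_add, map_smul, LinearMap.add_apply,
    LinearMap.smul_apply, wedge_self]
  rw [wedge_swap (KaehlerDifferential.D k _ f₃) (KaehlerDifferential.D k _ f₂)]
  module

theorem formDeg_C_smul_le {l : ℕ} (c : k)
    (ω : ⋀[MvPolynomial (Fin n) k]^l (Ω[MvPolynomial (Fin n) k⁄k])) :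
    formDeg w ((C c : MvPolynomial (Fin n) k) • ω) ≤ formDeg w ω := by
  rcases eq_or_ne c 0 with rfl | hc
  · simp
  · rw [formDeg_smul, wdeg_C w hc, WithBot.coe_zero, zero_add]

theorem formDeg_C_smul {l : ℕ} (hc : c ≠ 0)
    (ω : ⋀[MvPolynomial (Fin n) k]^l (Ω[MvPolynomial (Fin n) k⁄k])) :
    formDeg w ((C c : MvPolynomial (Fin n) k) • ω) = formDeg w ω := by
  rw [formDeg_smul, wdeg_C w hc, WithBot.coe_zero, zero_add]

theorem formDeg_smul_le_of_le {l : ℕ} {p : MvPolynomial (Fin n) k}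
    {ω : ⋀[MvPolynomial (Fin n) k]^l (Ω[MvPolynomial (Fin n) k⁄k])} {α β : Γ}
    (hp : wdeg w p ≤ α) (hω : formDeg w ω ≤ β) : formDeg w (p • ω) ≤ (α + β : Γ) := by
  rw [formDeg_smul, WithBot.coe_add]
  exact add_le_add hp hω

namespace Expansion

/-- Passing from `g₁` to `f₁` does not change the degree of the product with `df₃`, because
`deg η < (s - 2) δ`. -/
theorem formDeg_f13 (h : Expansion w F G r δ e a₃ ε a b c d ψ η) :
    formDeg w (dWedge (F 0) (F 2)) = (2 • (r • δ) + δ + ε : Γ) := by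
  have h1 : dWedge (F 0) (F 2) = dWedge (G 0) (F 2) + -(η • dWedge (F 1) (F 2)) := by
    simp only [dWedge_eq_wedge, D_g1_eq h.g1_eq h.D_psi, map_add, map_smul, LinearMap.add_apply,
      LinearMap.smul_apply, wedge_self]
    module
  rw [h1, formDeg_add_eq_left, h.formDeg_g1_f3]
  rw [formDeg_neg, h.formDeg_g1_f3]
  refine (formDeg_smul_le_of_le h.wdeg_eta h.formDeg_f23.le).trans_lt (WithBot.coe_lt_coe.2 ?_)
  have hδ := h.delta_pos
  clear * - hδ
  generalize r • δ = ρ at *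
  grind

omit [IsOrderedAddMonoid Γ] in
theorem dWedge_f12 (h : Expansion w F G r δ e a₃ ε a b c d ψ η) :
    dWedge (F 0) (F 1) = (C (2 * a) * F 2) • dWedge (F 1) (F 2) +
      (-((C b : MvPolynomial (Fin n) k) • dWedge (F 0) (F 2)) +
        ((C c : MvPolynomial (Fin n) k) • dWedge (F 1) (F 2) +
          (-((C b * η) • dWedge (F 1) (F 2)) + dWedge (G 0) (G 1)))) := by
  rw [dWedge_eq_of_expansion h.g1_eq h.g2_eq h.D_psi]
  module

/-- If `a ≠ 0`, the term `2 a f₃ df₂ ∧ df₃` dominates `df₁ ∧ df₂`. -/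
theorem formDeg_f12_of_a_ne_zero [CharZero k] (h : Expansion w F G r δ e a₃ ε a b c d ψ η)
    (ha : a ≠ 0) : formDeg w (dWedge (F 0) (F 1)) = (a₃ + ε : Γ) := by
  have hδ := h.delta_pos
  have hr := nsmul_delta_nonneg hδ r
  have hle := h.le_a₃
  have he := h.e_pos
  have hε := h.le_ε
  have h1 : formDeg w ((C (2 * a) * F 2) • dWedge (F 1) (F 2)) = (a₃ + ε : Γ) := by
    rw [formDeg_smul, wdeg_C_mul (mul_ne_zero two_ne_zero ha), h.wdeg_f3, h.formDeg_f23,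
      WithBot.coe_add]
  rw [h.dWedge_f12, formDeg_add_eq_left, h1]
  rw [h1]
  refine (formDeg_add_le _ _).trans_lt (max_lt ?_ ((formDeg_add_le _ _).trans_lt (max_lt ?_
    ((formDeg_add_le _ _).trans_lt (max_lt ?_ ?_)))))
  · rw [formDeg_neg]
    refine ((formDeg_C_smul_le _ _).trans h.formDeg_f13.le).trans_lt (WithBot.coe_lt_coe.2 ?_)
    clear * - hle he
    generalize r • δ = ρ at *
    grind
  · refine ((formDeg_C_smul_le _ _).trans h.formDeg_f23.le).trans_lt (WithBot.coe_lt_coe.2 ?_)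
    clear * - hle he hr hδ
    generalize r • δ = ρ at *
    grind
  · rw [formDeg_neg]
    refine (formDeg_smul_le_of_le ((wdeg_C_mul_le b η).trans h.wdeg_eta)
      h.formDeg_f23.le).trans_lt (WithBot.coe_lt_coe.2 ?_)
    clear * - hle he hδ
    generalize r • δ = ρ at *
    grind
  · rw [h.formDeg_g, WithBot.coe_lt_coe]
    clear * - hle hε he hr hδ
    generalize r • δ = ρ at *
    grind

/-- If `a = 0` and `b ≠ 0`, the term `b df₁ ∧ df₃` dominates `df₁ ∧ df₂`. -/
theorem formDeg_f12_of_b_ne_zero (h : Expansion w F G r δ e a₃ ε a b c d ψ η)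
    (ha : a = 0) (hb : b ≠ 0) :
    formDeg w (dWedge (F 0) (F 1)) = (2 • (r • δ) + δ + ε : Γ) := by
  have hδ := h.delta_pos
  have hr := nsmul_delta_nonneg hδ r
  have he := h.e_pos
  have hε := h.le_ε
  have h1 : formDeg w (-((C b : MvPolynomial (Fin n) k) • dWedge (F 0) (F 2))) =
      (2 • (r • δ) + δ + ε : Γ) := by
    rw [formDeg_neg, formDeg_C_smul hb, h.formDeg_f13]
  rw [h.dWedge_f12, ha, mul_zero, C_0, zero_mul, zero_smul, zero_add, formDeg_add_eq_left, h1]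
  rw [h1]
  refine (formDeg_add_le _ _).trans_lt (max_lt ?_ ((formDeg_add_le _ _).trans_lt (max_lt ?_ ?_)))
  · refine ((formDeg_C_smul_le _ _).trans h.formDeg_f23.le).trans_lt (WithBot.coe_lt_coe.2 ?_)
    clear * - hr hδ
    generalize r • δ = ρ at *
    grind
  · rw [formDeg_neg]
    refine (formDeg_smul_le_of_le ((wdeg_C_mul_le b η).trans h.wdeg_eta)
      h.formDeg_f23.le).trans_lt (WithBot.coe_lt_coe.2 ?_)
    clear * - hδ
    generalize r • δ = ρ at *
    grind
  · rw [h.formDeg_g, WithBot.coe_lt_coe]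
    clear * - hε hr hδ
    generalize r • δ = ρ at *
    grind

theorem formDeg_f12_of_c_ne_zero (h : Expansion w F G r δ e a₃ ε a b c d ψ η)
    (ha : a = 0) (hb : b = 0) (hc : c ≠ 0) :
    formDeg w (dWedge (F 0) (F 1)) = ε := by
  have hδ := h.delta_pos
  have hr := nsmul_delta_nonneg hδ r
  have hε := h.le_ε
  rw [h.dWedge_f12, ha, hb]
  simp only [mul_zero, C_0, zero_mul, zero_smul, neg_zero, zero_add]
  rw [formDeg_add_eq_left, formDeg_C_smul hc, h.formDeg_f23]
  rw [formDeg_C_smul hc, h.formDeg_f23, h.formDeg_g, WithBot.coe_lt_coe]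
  clear * - hε hr hδ
  generalize r • δ = ρ at *
  grind

omit [IsOrderedAddMonoid Γ] in
theorem formDeg_f12_of_eq_zero (h : Expansion w F G r δ e a₃ ε a b c d ψ η)
    (ha : a = 0) (hb : b = 0) (hc : c = 0) :
    formDeg w (dWedge (F 0) (F 1)) = formDeg w (dWedge (G 0) (G 1)) := by
  rw [h.dWedge_f12, ha, hb, hc]
  simp

/-- Unless `a = b = c = 0`, the form `df₁ ∧ df₂` has at least the degree of `df₂ ∧ df₃`. -/
theorem exists_formDeg_f12 [CharZero k] (h : Expansion w F G r δ e a₃ ε a b c d ψ η)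
    (hne : ¬ (a = 0 ∧ b = 0 ∧ c = 0)) :
    ∃ ε' : Γ, formDeg w (dWedge (F 0) (F 1)) = ε' ∧ ε ≤ ε' := by
  have hδ := h.delta_pos
  have hr := nsmul_delta_nonneg hδ r
  have hle := h.le_a₃
  have he := h.e_pos
  by_cases ha : a = 0
  · by_cases hb : b = 0
    · exact ⟨ε, h.formDeg_f12_of_c_ne_zero ha hb fun hc => hne ⟨ha, hb, hc⟩, le_rfl⟩
    · refine ⟨_, h.formDeg_f12_of_b_ne_zero ha hb, ?_⟩
      clear * - hr hδ
      generalize r • δ = ρ at *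
      grind
  · refine ⟨_, h.formDeg_f12_of_a_ne_zero ha, ?_⟩
    clear * - hr hδ hle he
    generalize r • δ = ρ at *
    grind

theorem r_eq_zero_of_a₃_le (h : Expansion w F G r δ e a₃ ε a b c d ψ η) (ha : a₃ ≤ 2 • δ) :
    r = 0 := by
  by_contra hr
  have hδ := h.delta_pos
  have h1 := delta_le_nsmul hδ hr
  have hle := h.le_a₃
  have he := h.e_pos
  clear * - h1 hle he ha hδ
  generalize r • δ = ρ at *
  grind

theorem a₃_le_of_a_ne_zero (h : Expansion w F G r δ e a₃ ε a b c d ψ η) (ha : a ≠ 0) :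
    a₃ ≤ 2 • δ := by
  have h1 := h.of_a_ne_zero ha
  have hδ := h.delta_pos
  have hr := nsmul_delta_nonneg hδ r
  have hle := h.le_a₃
  have he := h.e_pos
  clear * - h1 hle he hr hδ
  generalize r • δ = ρ at *
  grind

theorem a_eq_zero_of_a₃_eq (h : Expansion w F G r δ e a₃ ε a b c d ψ η)
    (ha₃ : a₃ = 2 • (r • δ) + 3 • δ) : a = 0 := by
  by_contra ha
  have h1 := h.of_a_ne_zero ha
  have hδ := h.delta_pos
  have hr := nsmul_delta_nonneg hδ r
  clear * - h1 ha₃ hr hδ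
  generalize r • δ = ρ at *
  grind

omit [IsOrderedAddMonoid Γ] in
theorem lead_f3_ne_C_mul_lead_g1 (hQ : QuasiSU w F G) (c : k) :
    lead w (F 2) ≠ C c * lead w (G 0) := by
  intro hl
  refine hQ.su4_lead ?_
  rw [hl]
  exact mul_mem (Subalgebra.algebraMap_mem _ _) (Algebra.subset_adjoin (by simp))

/-- The component of `g₁` in degree `s δ`, to which `ψ` does not contribute. -/
theorem lead_g1_eq (h : Expansion w F G r δ e a₃ ε a b c d ψ η) :
    lead w (G 0) = weightedHomogeneousComponent w (2 • (r • δ) + 3 • δ) (F 0) +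
      C a * weightedHomogeneousComponent w (2 • (r • δ) + 3 • δ) (F 2 ^ 2) +
        C c * weightedHomogeneousComponent w (2 • (r • δ) + 3 • δ) (F 2) := by
  have hδ := h.delta_pos
  have hψ : wdeg w ψ < (2 • (r • δ) + 3 • δ : Γ) := by
    refine h.wdeg_psi.trans_lt (WithBot.coe_lt_coe.2 ?_)
    clear * - hδ
    generalize r • δ = ρ at *
    grind
  rw [lead_eq_component h.wdeg_g1, h.g1_eq, map_add, map_add, map_add,
    component_eq_zero_of_wdeg_lt hψ, add_zero, weightedHomogeneousComponent_C_mul,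
    weightedHomogeneousComponent_C_mul]

theorem two_nsmul_a₃_eq (h : Expansion w F G r δ e a₃ ε a b c d ψ η)
    (ha : 2 • a₃ = 2 • (r • δ) + 3 • δ) : r = 0 ∧ 2 • a₃ = 3 • δ := by
  have hr : r = 0 := by
    by_contra hr
    have hδ := h.delta_pos
    have h1 := delta_le_nsmul hδ hr
    have hle := h.le_a₃
    have he := h.e_pos
    clear * - h1 hle he ha hδ
    generalize r • δ = ρ at *
    grind
  refine ⟨hr, ?_⟩
  rw [ha, hr, zero_nsmul, nsmul_zero, zero_add]

/-- If `deg f₁ < deg g₁`, then `g₁ ^ w` comes from the term `a f₃ ^ 2`; the bound for `deg f₁` is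
`deg f₁ + deg f₂ ≥ deg df₁ ∧ df₂ = deg f₃ + deg df₂ ∧ df₃`. -/
theorem of_wdeg_f1_lt [CharZero k] (h : Expansion w F G r δ e a₃ ε a b c d ψ η)
    (hQ : QuasiSU w F G) (hlt : wdeg w (F 0) < wdeg w (G 0)) :
    r = 0 ∧ 2 • a₃ = 3 • δ ∧ (∃ c' : k, c' ≠ 0 ∧ lead w (G 0) = C c' * lead w (F 2) ^ 2) ∧
      ∃ a₁ : Γ, wdeg w (F 0) = a₁ ∧ 5 • δ + 2 • e ≤ 2 • a₁ := by
  have hδ := h.delta_pos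
  have hε := h.le_ε
  rw [h.wdeg_g1] at hlt
  have hlead := h.lead_g1_eq
  rw [component_eq_zero_of_wdeg_lt hlt, zero_add] at hlead
  have hne := lead_ne_zero h.wdeg_g1
  have ha₃ : a₃ ≠ 2 • (r • δ) + 3 • δ := by
    intro ha₃
    rw [h.a_eq_zero_of_a₃_eq ha₃, C_0, zero_mul, zero_add, ← ha₃,
      ← lead_eq_component h.wdeg_f3] at hlead
    have hc : c ≠ 0 := by
      rintro rfl
      rw [C_0, zero_mul] at hlead
      exact hne hlead
    refine lead_f3_ne_C_mul_lead_g1 hQ c⁻¹ ?_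
    rw [hlead, ← mul_assoc, ← C_mul, inv_mul_cancel₀ hc, C_1, one_mul]
  have hf3 : wdeg w (F 2) < (2 • (r • δ) + 3 • δ : Γ) := by
    rw [h.wdeg_f3, WithBot.coe_lt_coe]
    exact lt_of_le_of_ne h.a₃_le ha₃
  rw [component_eq_zero_of_wdeg_lt hf3, mul_zero, add_zero] at hlead
  have ha : a ≠ 0 := by
    rintro rfl
    rw [C_0, zero_mul] at hlead
    exact hne hlead
  have hsq := wdeg_pow h.wdeg_f3 2
  have h2a : 2 • a₃ = 2 • (r • δ) + 3 • δ := by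
    refine le_antisymm (h.of_a_ne_zero ha) ?_
    rw [hlead] at hne
    have := le_wdeg_of_component_ne_zero (right_ne_zero_of_mul hne)
    rwa [hsq, WithBot.coe_le_coe] at this
  rw [← h2a, ← lead_eq_component hsq, lead_pow] at hlead
  obtain ⟨hr, h3⟩ := h.two_nsmul_a₃_eq h2a
  refine ⟨hr, h3, ⟨a, ha, hlead⟩, ?_⟩
  have hform := formDeg_dWedge_le (w := w) (F 0) (F 1)
  rw [h.formDeg_f12_of_a_ne_zero ha, h.wdeg_f2] at hform
  have hf0 : F 0 ≠ 0 := by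
    intro h0
    rw [h0, wdeg_zero, WithBot.bot_add] at hform
    exact WithBot.coe_ne_bot (le_bot_iff.1 hform)
  obtain ⟨a₁, ha₁⟩ := exists_wdeg_eq w hf0
  refine ⟨a₁, ha₁, ?_⟩
  rw [ha₁, ← WithBot.coe_add, WithBot.coe_le_coe] at hform
  clear * - hform h3 h2a hε
  generalize r • δ = ρ at *
  grind

/-- Either `deg f₁ = s δ`, or the exceptional case `s = 3`, `deg f₃ = 3 δ / 2` occurs. -/
theorem exists_wdeg_f1 [CharZero k] (h : Expansion w F G r δ e a₃ ε a b c d ψ η)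
    (hQ : QuasiSU w F G) : ∃ a₁ : Γ, wdeg w (F 0) = a₁ ∧ a₁ ≤ 2 • (r • δ) + 3 • δ ∧
      2 • δ < a₁ ∧ a₃ ≤ a₁ ∧
      (a₁ = 2 • (r • δ) + 3 • δ ∨
        a₁ < 2 • (r • δ) + 3 • δ ∧ r = 0 ∧ 2 • a₃ = 3 • δ ∧ 5 • δ + 2 • e ≤ 2 • a₁) := by
  have hδ := h.delta_pos
  have he := h.e_pos
  have hr := nsmul_delta_nonneg hδ r
  have hle := h.a₃_le
  rcases lt_or_eq_of_le hQ.su2_fst with hlt | heq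
  · obtain ⟨hr0, h3, -, a₁, ha₁, h5⟩ := h.of_wdeg_f1_lt hQ hlt
    have hlt' : a₁ < 2 • (r • δ) + 3 • δ := by
      rwa [ha₁, h.wdeg_g1, WithBot.coe_lt_coe] at hlt
    refine ⟨a₁, ha₁, hlt'.le, ?_, ?_, Or.inr ⟨hlt', hr0, h3, h5⟩⟩
    · clear * - h5 he hδ
      grind
    · clear * - h5 h3 he hδ
      grind
  · refine ⟨_, heq.trans h.wdeg_g1, le_rfl, ?_, hle, Or.inl rfl⟩
    clear * - hr hδ
    generalize r • δ = ρ at *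
    grind

theorem lead_f1_ne_C_mul_lead_f3 [CharZero k] (h : Expansion w F G r δ e a₃ ε a b c d ψ η)
    (hQ : QuasiSU w F G) (c' : k) : lead w (F 0) ≠ C c' * lead w (F 2) := by
  intro hl
  obtain ⟨a₁, ha₁, -, -, -, hcase⟩ := h.exists_wdeg_f1 hQ
  have hc' : c' ≠ 0 := by
    rintro rfl
    exact lead_ne_zero ha₁ (by simpa using hl)
  have h13 : a₁ = a₃ := by
    have := congrArg (wdeg w) hl
    rw [wdeg_C_mul hc', wdeg_lead, wdeg_lead, ha₁, h.wdeg_f3] at this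
    exact WithBot.coe_injective this
  have hδ := h.delta_pos
  have he := h.e_pos
  rcases hcase with h1 | ⟨-, -, h3, h5⟩
  swap
  · clear * - h13 h3 h5 hδ he
    grind
  have ha₃ := h13.symm.trans h1
  have hlead := h.lead_g1_eq
  rw [h.a_eq_zero_of_a₃_eq ha₃, C_0, zero_mul, add_zero, ← ha₃, ← lead_eq_component h.wdeg_f3,
    ← h13, ← lead_eq_component ha₁, hl, ← add_mul, ← C_add] at hlead
  have hne := lead_ne_zero h.wdeg_g1
  rw [hlead] at hne
  have hcc : c' + c ≠ 0 := by
    intro h0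
    simp [h0] at hne
  refine lead_f3_ne_C_mul_lead_g1 hQ (c' + c)⁻¹ ?_
  rw [hlead, ← mul_assoc, ← C_mul, inv_mul_cancel₀ hcc, C_1, one_mul]

/-- The only way for `f₁ ^ w` to be a polynomial in `f₃ ^ w` is to be proportional to its square;
higher powers have degree above `s δ`. -/
theorem of_lead_f1_mem [CharZero k] (h : Expansion w F G r δ e a₃ ε a b c d ψ η)
    (hQ : QuasiSU w F G) (hmem : lead w (F 0) ∈ Algebra.adjoin k {lead w (F 2)}) :
    r = 0 ∧ 2 • a₃ = 3 • δ ∧ ∃ c' : k, lead w (F 0) = C c' * lead w (F 2) ^ 2 := by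
  obtain ⟨a₁, ha₁, ha₁le, h2δ, -, hcase⟩ := h.exists_wdeg_f1 hQ
  have hδ := h.delta_pos
  have he := h.e_pos
  have hr := nsmul_delta_nonneg hδ r
  have hle := h.le_a₃
  have ha0 : 0 < a₃ := by
    clear * - hδ hr hle he
    generalize r • δ = ρ at *
    grind
  obtain ⟨l, c', hc', hl, hdeg⟩ := exists_pow_of_lead_mem_adjoin h.wdeg_f3 ha0
    (ne_zero_of_wdeg_eq ha₁) hmem
  rw [ha₁, WithBot.coe_inj] at hdeg
  have hl2 : l = 2 := by
    by_contra hne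
    rcases Nat.lt_or_ge l 3 with hlt | hge
    · have : l = 0 ∨ l = 1 := by omega
      rcases this with rfl | rfl
      · rw [zero_nsmul] at hdeg
        clear * - hδ hdeg h2δ
        grind
      · rw [pow_one] at hl
        exact h.lead_f1_ne_C_mul_lead_f3 hQ c' hl
    · have h3 : 3 • a₃ ≤ l • a₃ := nsmul_le_nsmul_left ha0.le hge
      rw [← hdeg] at h3
      clear * - h3 hle ha₁le hr hδ he
      generalize r • δ = ρ at *
      grind
  rw [hl2] at hl hdeg
  rcases hcase with h1 | ⟨-, hr0, h3, -⟩
  · obtain ⟨hr0, h3⟩ := h.two_nsmul_a₃_eq (hdeg.symm.trans h1)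
    exact ⟨hr0, h3, c', hl⟩
  · exact ⟨hr0, h3, c', hl⟩

theorem lead_f1_notMem_f2 [CharZero k] (h : Expansion w F G r δ e a₃ ε a b c d ψ η)
    (hQ : QuasiSU w F G) : lead w (F 0) ∉ Algebra.adjoin k {lead w (F 1)} := by
  intro hmem
  obtain ⟨a₁, ha₁, -, hlt, -, hcase⟩ := h.exists_wdeg_f1 hQ
  have hδ := h.delta_pos
  have he := h.e_pos
  have h2δ : 0 < 2 • δ := by clear * - hδ; grind
  obtain ⟨l, c', hc', hl, hdeg⟩ := exists_pow_of_lead_mem_adjoin h.wdeg_f2 h2δ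
    (ne_zero_of_wdeg_eq ha₁) hmem
  rw [ha₁, WithBot.coe_inj] at hdeg
  rcases hcase with h1 | ⟨h1, rfl, h3, h5⟩
  · have h2 : (l * 2) • δ = (2 * r + 3) • δ := by
      rw [mul_nsmul', ← hdeg, h1, add_nsmul, mul_nsmul']
    have := nsmul_injective_of_pos hδ h2
    omega
  · have hl1 : 1 < l := by
      by_contra! hle
      have : l • (2 • δ) ≤ 1 • (2 • δ) := nsmul_le_nsmul_left h2δ.le hle
      rw [← hdeg, one_nsmul] at this
      exact absurd hlt (not_lt.2 this)
    have h4 : 2 • (2 • δ) ≤ l • (2 • δ) := nsmul_le_nsmul_left h2δ.le hl1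
    rw [← hdeg] at h4
    rw [zero_nsmul] at h1
    clear * - h1 h4 hδ
    grind

theorem lead_f2_notMem_f1 [CharZero k] (h : Expansion w F G r δ e a₃ ε a b c d ψ η)
    (hQ : QuasiSU w F G) : lead w (F 1) ∉ Algebra.adjoin k {lead w (F 0)} := by
  intro hmem
  obtain ⟨a₁, ha₁, -, hlt, -, -⟩ := h.exists_wdeg_f1 hQ
  have hδ := h.delta_pos
  have ha0 : 0 < a₁ := by clear * - hδ hlt; grind
  obtain ⟨l, c', -, -, hdeg⟩ := exists_pow_of_lead_mem_adjoin ha₁ ha0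
    (ne_zero_of_wdeg_eq h.wdeg_f2) hmem
  rw [h.wdeg_f2, WithBot.coe_inj] at hdeg
  rcases eq_or_ne l 0 with rfl | hl
  · rw [zero_nsmul] at hdeg
    clear * - hδ hdeg
    grind
  · have := delta_le_nsmul ha0 hl
    rw [← hdeg] at this
    exact absurd hlt (not_lt.2 this)

theorem lead_f3_notMem_f1 [CharZero k] (h : Expansion w F G r δ e a₃ ε a b c d ψ η)
    (hQ : QuasiSU w F G) : lead w (F 2) ∉ Algebra.adjoin k {lead w (F 0)} := by
  intro hmem
  obtain ⟨a₁, ha₁, -, hlt, h31, -⟩ := h.exists_wdeg_f1 hQ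
  have hδ := h.delta_pos
  have hr := nsmul_delta_nonneg hδ r
  have hle := h.le_a₃
  have he := h.e_pos
  have ha0 : 0 < a₁ := by clear * - hδ hlt; grind
  obtain ⟨l, c', hc', hl, hdeg⟩ := exists_pow_of_lead_mem_adjoin ha₁ ha0
    (ne_zero_of_wdeg_eq h.wdeg_f3) hmem
  rw [h.wdeg_f3, WithBot.coe_inj] at hdeg
  rcases Nat.lt_or_ge l 2 with hlt2 | hge
  · have : l = 0 ∨ l = 1 := by omega
    rcases this with rfl | rfl
    · rw [zero_nsmul] at hdeg
      clear * - hδ hdeg hle hr he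
      generalize r • δ = ρ at *
      grind
    · rw [pow_one] at hl
      refine h.lead_f1_ne_C_mul_lead_f3 hQ c'⁻¹ ?_
      rw [hl, ← mul_assoc, ← C_mul, inv_mul_cancel₀ hc', C_1, one_mul]
  · have h3 : 2 • a₁ ≤ l • a₁ := nsmul_le_nsmul_left ha0.le hge
    rw [← hdeg] at h3
    clear * - h3 h31 ha0
    grind

/-- Expressions of `f₁` and `f₃` of degree at most `deg f₂` are affine in `f₃`: the degree of
`df₁ ∧ df₃` excludes cancellation, and `deg f₁ > deg f₂`. -/
theorem exists_affine_of_mem_f13 [CharZero k] (hw : ∀ i, 0 < w i)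
    (h : Expansion w F G r δ e a₃ ε a b c d ψ η) (hQ : QuasiSU w F G)
    {φ : MvPolynomial (Fin n) k} (hφ : φ ∈ Algebra.adjoin k {F 0, F 2})
    (hle : wdeg w φ ≤ wdeg w (F 1)) : ∃ b' d' : k, φ = C b' * F 2 + C d' := by
  rw [Set.pair_comm] at hφ
  obtain ⟨P, rfl⟩ := mem_adjoin_pair_iff.1 hφ
  obtain ⟨a₁, ha₁, -, hlt, h31, -⟩ := h.exists_wdeg_f1 hQ
  have hδ := h.delta_pos
  have hr := nsmul_delta_nonneg hδ r
  have ha := h.le_a₃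
  have he := h.e_pos
  have hε := h.le_ε
  have ha₁0 : 0 < a₁ := by clear * - hδ hlt; grind
  have ha0 : 0 < a₃ := by
    clear * - hδ hr ha he
    generalize r • δ = ρ at *
    grind
  rw [h.wdeg_f2] at hle
  have hform := (formDeg_dWedge_swap (w := w) (F 2) (F 0)).trans h.formDeg_f13
  have hwt : ∀ d, coeff d P ≠ 0 → d 0 • a₃ + d 1 • a₁ ≤ 2 • δ := by
    intro d hd
    rw [← WithBot.coe_le_coe]
    refine (weight_le_of_wdeg_aeval_le hw h.wdeg_f3 ha₁ ha0 ha₁0 hform (D := 2 • δ) ?_ ?_ hle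
      hd).trans hle
    · clear * - hδ
      grind
    · intro p q c' hp hq hc' hrel hl
      rcases Nat.lt_or_ge p 2 with hp1 | hp2
      · obtain rfl : p = 1 := by omega
        rw [pow_one] at hl
        obtain ⟨-, h3, -⟩ := h.of_lead_f1_mem hQ (mem_adjoin_of_eq_C_mul_pow hl)
        rw [one_nsmul]
        clear * - h3 hε hr he hδ
        generalize r • δ = ρ at *
        grind
      · have h1 : 2 • a₁ ≤ p • a₁ := nsmul_le_nsmul_left ha₁0.le hp2
        clear * - h1 hε hr he hδ h31
        generalize r • δ = ρ at *
        generalize p • a₁ = u at *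
        grind
  have hd1 : ∀ d, coeff d P ≠ 0 → d 1 = 0 := by
    intro d hd
    by_contra h1
    have h2 := (le_add_of_nonneg_left (nsmul_nonneg ha0.le (d 0))).trans (hwt d hd)
    have h3 := (delta_le_nsmul ha₁0 h1).trans h2
    exact absurd hlt (not_lt.2 h3)
  obtain ⟨hmem, -⟩ := aeval_mem_adjoin_left (w := w) (y := F 0) h.wdeg_f3 (Q := P)
    (B := (2 • δ : Γ)) fun d hd => by
      refine ⟨hd1 d hd, WithBot.coe_le_coe.2 ?_⟩
      have := hwt d hd
      rwa [hd1 d hd, zero_nsmul, add_zero] at this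
  obtain ⟨b', d', h1, -⟩ := h.exists_affine hmem hle
  exact ⟨b', d', h1⟩

/-- Expressions of `f₁` and `f₂` of degree at most `deg f₁`. If `k[g₁, g₂] ≠ k[f₁, f₂]`, then `a`,
`b`, `c` are not all zero, so `df₁ ∧ df₂` has large degree and there is no cancellation. -/
theorem exists_of_mem_f12 [CharZero k] (hw : ∀ i, 0 < w i)
    (h : Expansion w F G r δ e a₃ ε a b c d ψ η) (hQ : QuasiSU w F G)
    (hne : Algebra.adjoin k {G 0, G 1} ≠ Algebra.adjoin k {F 0, F 1})
    {φ : MvPolynomial (Fin n) k} (hφ : φ ∈ Algebra.adjoin k {F 0, F 1})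
    (hle : wdeg w φ ≤ wdeg w (F 0)) : ∃ c' : k, ∃ ψ' ∈ Algebra.adjoin k {F 1},
      wdeg w ψ' ≤ min ((2 • (r • δ) + 2 • δ : Γ) : WithBot Γ) (wdeg w φ) ∧
        φ = C c' * F 0 + ψ' ∧ (wdeg w φ < wdeg w (F 0) → c' = 0) := by
  classical
  have habc : ¬ (a = 0 ∧ b = 0 ∧ c = 0) := by
    rintro ⟨ha, hb, hc⟩
    have h1 : G 0 = F 0 + ψ := by simpa [ha, hc] using h.g1_eq
    have h2 : G 1 = F 1 + C d := by simpa [hb] using h.g2_eq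
    have hC : ∀ S : Subalgebra k (MvPolynomial (Fin n) k), C d ∈ S := fun S =>
      S.algebraMap_mem d
    have hψ : ∀ S : Subalgebra k (MvPolynomial (Fin n) k), F 1 ∈ S → ψ ∈ S := fun S hS =>
      Algebra.adjoin_le (Set.singleton_subset_iff.2 hS) h.psi_mem
    have hG0 : G 0 ∈ Algebra.adjoin k {G 0, G 1} := Algebra.subset_adjoin (by simp)
    have hG1 : G 1 ∈ Algebra.adjoin k {G 0, G 1} := Algebra.subset_adjoin (by simp)
    have hF0 : F 0 ∈ Algebra.adjoin k {F 0, F 1} := Algebra.subset_adjoin (by simp)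
    have hF1 : F 1 ∈ Algebra.adjoin k {F 0, F 1} := Algebra.subset_adjoin (by simp)
    have hF1' : F 1 ∈ Algebra.adjoin k {G 0, G 1} := by
      rw [eq_sub_of_add_eq h2.symm]
      exact sub_mem hG1 (hC _)
    have hF0' : F 0 ∈ Algebra.adjoin k {G 0, G 1} := by
      rw [eq_sub_of_add_eq h1.symm]
      exact sub_mem hG0 (hψ _ hF1')
    have hG0' : G 0 ∈ Algebra.adjoin k {F 0, F 1} := by
      rw [h1]
      exact add_mem hF0 (hψ _ hF1)
    have hG1' : G 1 ∈ Algebra.adjoin k {F 0, F 1} := by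
      rw [h2]
      exact add_mem hF1 (hC _)
    refine hne (le_antisymm (Algebra.adjoin_le ?_) (Algebra.adjoin_le ?_))
    · exact Set.insert_subset hG0' (Set.singleton_subset_iff.2 hG1')
    · exact Set.insert_subset hF0' (Set.singleton_subset_iff.2 hF1')
  obtain ⟨ε', hε', hεε'⟩ := h.exists_formDeg_f12 habc
  rw [Set.pair_comm] at hφ
  obtain ⟨P, rfl⟩ := mem_adjoin_pair_iff.1 hφ
  obtain ⟨a₁, ha₁, ha₁le, hlt, h31, -⟩ := h.exists_wdeg_f1 hQ
  have hδ := h.delta_pos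
  have hr := nsmul_delta_nonneg hδ r
  have he := h.e_pos
  have hε := h.le_ε
  have h2δ : 0 < 2 • δ := by clear * - hδ; grind
  have ha₁0 : 0 < a₁ := by clear * - hδ hlt; grind
  rw [ha₁] at hle
  have hform := (formDeg_dWedge_swap (w := w) (F 1) (F 0)).trans hε'
  have hwt' : ∀ d, coeff d P ≠ 0 →
      ((d 0 • (2 • δ) + d 1 • a₁ : Γ) : WithBot Γ) ≤ wdeg w (aeval ![F 1, F 0] P) := by
    intro d hd
    refine weight_le_of_wdeg_aeval_le hw h.wdeg_f2 ha₁ h2δ ha₁0 hform ha₁0.le ?_ hle hd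
    intro p q c' hp hq hc' hrel hl
    have hp2 : 2 ≤ p := by
      by_contra! hp1
      obtain rfl : p = 1 := by omega
      rw [pow_one] at hl
      exact h.lead_f1_notMem_f2 hQ (mem_adjoin_of_eq_C_mul_pow hl)
    have h1 : 2 • a₁ ≤ p • a₁ := nsmul_le_nsmul_left ha₁0.le hp2
    clear * - h1 hε hεε' hr he hδ
    generalize r • δ = ρ at *
    generalize p • a₁ = u at *
    grind
  have hwt : ∀ d, coeff d P ≠ 0 → d 0 • (2 • δ) + d 1 • a₁ ≤ a₁ := fun d hd =>
    WithBot.coe_le_coe.1 ((hwt' d hd).trans hle)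
  have hd1 : ∀ d, coeff d P ≠ 0 → d 1 = 0 ∨ d 1 = 1 ∧ d 0 = 0 := by
    intro d hd
    have h1 := hwt d hd
    have h0 : 0 ≤ d 0 • (2 • δ) := nsmul_nonneg h2δ.le _
    have h2 : d 1 ≤ 1 := le_of_nsmul_le_nsmul ha₁0 (by
      rw [one_nsmul]
      exact (le_add_of_nonneg_left h0).trans h1)
    rcases Nat.eq_zero_or_pos (d 1) with h3 | h3
    · exact Or.inl h3
    · have h4 : d 1 = 1 := by omega
      refine Or.inr ⟨h4, ?_⟩
      rw [h4, one_nsmul] at h1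
      by_contra h5
      have h6 := delta_le_nsmul h2δ h5
      clear * - h6 h1 h2δ
      generalize d 0 • (2 • δ) = u at *
      grind
  set c' := coeff (Finsupp.single 1 1) P with hc'_def
  set Q := P - monomial (Finsupp.single 1 1) c' with hQ_def
  have hQP : ∀ d, coeff d Q ≠ 0 → d 1 = 0 ∧ coeff d P ≠ 0 := by
    intro d hd
    rw [hQ_def, coeff_sub, coeff_monomial] at hd
    have hne1 : Finsupp.single 1 1 ≠ d := by
      rintro rfl
      rw [if_pos rfl, ← hc'_def] at hd
      simp at hd
    rw [if_neg hne1, sub_zero] at hd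
    refine ⟨(hd1 d hd).resolve_right fun h1 => ?_, hd⟩
    exact hne1 (pair_ext (by simp [h1.2]) (by simp [h1.1]))
  obtain ⟨hmem, hdeg⟩ := aeval_mem_adjoin_left (w := w) (y := F 0) h.wdeg_f2 (Q := Q)
    (B := min ((2 • (r • δ) + 2 • δ : Γ) : WithBot Γ) (wdeg w (aeval ![F 1, F 0] P)))
    fun d hd => by
      obtain ⟨h1, h2⟩ := hQP d hd
      have h3 := hwt d h2
      have h4 := hwt' d h2
      rw [h1, zero_nsmul, add_zero] at h3 h4
      exact ⟨h1, le_min (WithBot.coe_le_coe.2 (nsmul_two_nsmul_le hδ (h3.trans ha₁le))) h4⟩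
  refine ⟨c', _, hmem, hdeg, ?_, fun hlt' => ?_⟩
  · rw [hQ_def, map_sub, aeval_monomial, Finsupp.prod_single_index (by simp)]
    simp [algebraMap_eq]
  · by_contra h0
    have := hwt' _ h0
    rw [ha₁] at hlt'
    simp only [Finsupp.single_apply] at this
    simp at this
    exact absurd hlt' (not_lt.2 this)

/-- Uniqueness of `a`, `b`, `c`: for two pairs `(g₁, g₂)`, the difference of the forms `dg₁ ∧ dg₂`
has degree less than `df₂ ∧ df₃`, but is a combination of `df₁ ∧ df₃`, `f₃ df₂ ∧ df₃` and
`df₂ ∧ df₃`, whose degrees are different. -/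
theorem coeff_unique [CharZero k] (hw : ∀ i, 0 < w i) (hF : AlgebraicIndependent k F)
    (h : Expansion w F G r δ e a₃ ε a b c d ψ η) (hψ : ∃ x : k, ψ = C x)
    {G' : Fin 3 → MvPolynomial (Fin n) k} (hG' : AlgebraicIndependent k G')
    (hQ' : QuasiSU w F G') {a' b' c' d' x' : k}
    (h1' : G' 0 = F 0 + C a' * F 2 ^ 2 + C c' * F 2 + C x')
    (h2' : G' 1 = F 1 + C b' * F 2 + C d') : a' = a ∧ b' = b ∧ c' = c := by
  obtain ⟨x, rfl⟩ := hψ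
  obtain ⟨r', δ', e', a₃', ε', h'⟩ := hQ'.exists_core hw hF hG'
  obtain rfl : ε' = ε := WithBot.coe_injective (h'.formDeg_f23.symm.trans h.formDeg_f23)
  have hδ := h.delta_pos
  have hr := nsmul_delta_nonneg hδ r
  have hle := h.le_a₃
  have he := h.e_pos
  have hε := h.le_ε
  have hδ' := h'.delta_pos
  have hr' := nsmul_delta_nonneg hδ' r'
  have hε' := h'.le_ε
  have hC : ∀ y : k, KaehlerDifferential.D k (MvPolynomial (Fin n) k) (C y) =
      (0 : MvPolynomial (Fin n) k) • KaehlerDifferential.D k _ (F 1) := fun y => by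
    rw [D_C, zero_smul]
  have hA := h.formDeg_f13
  have hB := h.formDeg_f23
  set A := dWedge (F 0) (F 2)
  set B := dWedge (F 1) (F 2)
  have hdiff : dWedge (G' 0) (G' 1) + -dWedge (G 0) (G 1) =
      (C (2 * (a - a')) * F 2) • B + ((C (b' - b) : MvPolynomial (Fin n) k) • A +
        (C (c - c') : MvPolynomial (Fin n) k) • B) := by
    rw [dWedge_eq_of_expansion h1' h2' (hC x'), dWedge_eq_of_expansion h.g1_eq h.g2_eq (hC x)]
    simp only [C_mul, C_sub, mul_zero, sub_zero]
    module
  have hlt : formDeg w (dWedge (G' 0) (G' 1) + -dWedge (G 0) (G 1)) < ε' := by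
    refine (formDeg_add_le _ _).trans_lt (max_lt ?_ ?_)
    · rw [h'.formDeg_g, WithBot.coe_lt_coe]
      clear * - hε' hδ' hr'
      generalize r' • δ' = ρ at *
      grind
    · rw [formDeg_neg, h.formDeg_g, WithBot.coe_lt_coe]
      clear * - hε hδ hr
      generalize r • δ = ρ at *
      grind
  rw [hdiff] at hlt
  have haa : a' = a := by
    by_contra hne
    have h1 : formDeg w ((C (2 * (a - a')) * F 2) • B) = (a₃ + ε' : Γ) := by
      rw [formDeg_smul, wdeg_C_mul (mul_ne_zero two_ne_zero (sub_ne_zero.2 (Ne.symm hne))),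
        h.wdeg_f3, hB, WithBot.coe_add]
    rw [formDeg_add_eq_left, h1, WithBot.coe_lt_coe] at hlt
    · clear * - hlt hle hr hδ he
      generalize r • δ = ρ at *
      grind
    · rw [h1]
      refine (formDeg_add_le _ _).trans_lt (max_lt ?_ ?_)
      · refine ((formDeg_C_smul_le _ _).trans hA.le).trans_lt (WithBot.coe_lt_coe.2 ?_)
        clear * - hle he
        generalize r • δ = ρ at *
        grind
      · refine ((formDeg_C_smul_le _ _).trans hB.le).trans_lt (WithBot.coe_lt_coe.2 ?_)
        clear * - hle he hr hδ
        generalize r • δ = ρ at *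
        grind
  rw [haa, sub_self, mul_zero, C_0, zero_mul, zero_smul, zero_add] at hlt
  have hbb : b' = b := by
    by_contra hne
    have h1 := (formDeg_C_smul (w := w) (sub_ne_zero.2 hne) A).trans hA
    have h2 : 0 < 2 • (r • δ) + δ := by
      clear * - hr hδ
      generalize r • δ = ρ at *
      grind
    rw [formDeg_add_eq_left, h1, WithBot.coe_lt_coe] at hlt
    · exact absurd hlt (not_lt.2 (le_add_of_nonneg_left h2.le))
    · rw [h1]
      exact ((formDeg_C_smul_le _ _).trans hB.le).trans_lt
        (WithBot.coe_lt_coe.2 (lt_add_of_pos_left _ h2))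
  rw [hbb, sub_self, C_0, zero_smul, zero_add] at hlt
  refine ⟨haa, hbb, ?_⟩
  by_contra hne
  rw [formDeg_C_smul (sub_ne_zero.2 (Ne.symm hne)), hB] at hlt
  exact lt_irrefl _ hlt

end Expansion
end Conclusions
end ShestakovUmirbaev

/-! ### Properties of quasi Shestakov–Umirbaev pairs -/

open ShestakovUmirbaev in
theorem theorem4p2 {k : Type*} [Field k] [CharZero k]
    {Γ : Type*} [AddCommGroup Γ] [LinearOrder Γ] [IsOrderedAddMonoid Γ] [Module.Finite ℤ Γ]
    {n : ℕ} (hn : 3 ≤ n) (w : Fin n → Γ) (hw : ∀ i, 0 < w i)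
    (F G : Fin 3 → MvPolynomial (Fin n) k)
    (hF : AlgebraicIndependent k F) (hG : AlgebraicIndependent k G)
    (hFG : QuasiSU w F G) :
    -- (P1)
    ∃ s : ℕ, Odd s ∧ 3 ≤ s ∧ Approx (lead w (G 0) ^ 2) (lead w (G 1) ^ s) ∧
    ∃ δ : Γ, wdeg w (G 1) = ((2 • δ : Γ) : WithBot Γ) ∧
    -- (P2)
    ((((s : ℤ) - 2) • δ : Γ) : WithBot Γ) + formDeg w (dWedge (G 0) (G 1)) ≤ wdeg w (F 2) ∧
    -- (P3)
    wdeg w (F 1) = wdeg w (G 1) ∧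
    -- (P4)
    (∀ φ ∈ Algebra.adjoin k {F 1, F 2}, wdeg w φ ≤ wdeg w (G 0) →
      ∃ a' c' : k, ∃ ψ' ∈ Algebra.adjoin k {F 1},
        wdeg w ψ' ≤ ((((s : ℤ) - 1) • δ : Γ) : WithBot Γ) ∧
        φ = C a' * F 2 ^ 2 + C c' * F 2 + ψ') ∧
    -- (P5), with the half-integral multiples of `δ` cleared of denominators
    (wdeg w (F 0) < wdeg w (G 0) →
      s = 3 ∧ Approx (lead w (G 0)) (lead w (F 2) ^ 2) ∧
      2 • wdeg w (F 2) = ((3 • δ : Γ) : WithBot Γ) ∧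
      ((5 • δ : Γ) : WithBot Γ) + 2 • formDeg w (dWedge (G 0) (G 1)) ≤ 2 • wdeg w (F 0)) ∧
    -- (P6)
    tupleDeg w G < tupleDeg w F ∧
    -- (P7)
    (wdeg w (F 1) < wdeg w (F 0) ∧ wdeg w (F 2) ≤ wdeg w (F 0) ∧
      ∀ i, (δ : WithBot Γ) < wdeg w (F i) ∧ wdeg w (F i) ≤ ((s • δ : Γ) : WithBot Γ)) ∧
    -- (P8)
    ((∀ i j : Fin 3, i ≠ j → (i, j) ≠ (0, 2) →
        lead w (F i) ∉ Algebra.adjoin k {lead w (F j)}) ∧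
      (lead w (F 0) ∈ Algebra.adjoin k {lead w (F 2)} →
        s = 3 ∧ Approx (lead w (F 0)) (lead w (F 2) ^ 2) ∧
        2 • wdeg w (F 2) = ((3 • δ : Γ) : WithBot Γ))) ∧
    -- (P9)
    (∀ φ ∈ Algebra.adjoin k {F 0, F 2}, wdeg w φ ≤ wdeg w (F 1) →
      ∃ b' d' : k, φ = C b' * F 2 + C d') ∧
    -- (P10)
    (Algebra.adjoin k {G 0, G 1} ≠ Algebra.adjoin k {F 0, F 1} →
      ∀ φ ∈ Algebra.adjoin k {F 0, F 1}, wdeg w φ ≤ wdeg w (F 0) →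
        ∃ c'' : k, ∃ ψ'' ∈ Algebra.adjoin k {F 1},
          wdeg w ψ'' ≤ min ((((s : ℤ) - 1) • δ : Γ) : WithBot Γ) (wdeg w φ) ∧
          φ = C c'' * F 0 + ψ'' ∧
          (wdeg w φ < wdeg w (F 0) → c'' = 0)) ∧
    -- (P11)
    ∃ a b c d : k, ∃ ψ ∈ Algebra.adjoin k {F 1},
      wdeg w ψ ≤ ((((s : ℤ) - 1) • δ : Γ) : WithBot Γ) ∧
      G 0 = F 0 + C a * F 2 ^ 2 + C c * F 2 + ψ ∧
      G 1 = F 1 + C b * F 2 + C d ∧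
      (a ≠ 0 ∨ b ≠ 0 → wdeg w (F 2) ≤ wdeg w (F 1)) ∧
      (wdeg w (F 2) ≤ wdeg w (F 1) → s = 3) ∧
      ((∃ e : k, ψ = C e) →
        ∀ G' : Fin 3 → MvPolynomial (Fin n) k, AlgebraicIndependent k G' → QuasiSU w F G' →
          ∀ a' b' c' d' e' : k,
            G' 0 = F 0 + C a' * F 2 ^ 2 + C c' * F 2 + C e' →
            G' 1 = F 1 + C b' * F 2 + C d' →
            a' = a ∧ b' = b ∧ c' = c) ∧
      -- (P12)
      (a ≠ 0 → formDeg w (dWedge (F 0) (F 1)) = wdeg w (F 2) + formDeg w (dWedge (F 1) (F 2))) ∧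
      (a = 0 → b ≠ 0 → formDeg w (dWedge (F 0) (F 1)) = formDeg w (dWedge (F 0) (F 2))) ∧
      (a = 0 → b = 0 → c ≠ 0 →
        formDeg w (dWedge (F 0) (F 1)) = formDeg w (dWedge (F 1) (F 2))) ∧
      (a = 0 → b = 0 → c = 0 →
        formDeg w (dWedge (F 0) (F 1)) = formDeg w (dWedge (G 0) (G 1))) ∧
      formDeg w (dWedge (F 0) (F 2)) =
        ((((s : ℤ) - 2) • δ : Γ) : WithBot Γ) + formDeg w (dWedge (F 1) (F 2)) ∧
      ((s • δ : Γ) : WithBot Γ) + formDeg w (dWedge (G 0) (G 1)) ≤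
        formDeg w (dWedge (F 1) (F 2)) := by
  obtain ⟨r, δ, e, a₃, ε, hcore⟩ := hFG.exists_core hw hF hG
  obtain ⟨a, b, c, d, ψ, η, h⟩ := hcore.exists_expansion hw hFG
  obtain ⟨a₁, ha₁, ha₁le, h2δ, h31, hcase⟩ := h.exists_wdeg_f1 hFG
  have hδ := h.delta_pos
  have hr := nsmul_delta_nonneg hδ r
  have he := h.e_pos
  have hle := h.le_a₃
  have hle' := h.a₃_le
  -- The multiples of `δ` in the statement, for `s = 2 r + 3`.
  have hs : (2 * r + 3) • δ = 2 • (r • δ) + 3 • δ := by rw [add_nsmul, mul_nsmul']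
  have hs1 : (((2 * r + 3 : ℕ) : ℤ) - 1) • δ = 2 • (r • δ) + 2 • δ := by
    have : ((2 * r + 3 : ℕ) : ℤ) - 1 = ((2 * r + 2 : ℕ) : ℤ) := by push_cast; ring
    rw [this, natCast_zsmul, add_nsmul, mul_nsmul']
  have hs2 : (((2 * r + 3 : ℕ) : ℤ) - 2) • δ = 2 • (r • δ) + δ := by
    have : ((2 * r + 3 : ℕ) : ℤ) - 2 = ((2 * r + 1 : ℕ) : ℤ) := by push_cast; ring
    rw [this, natCast_zsmul, add_nsmul, mul_nsmul', one_nsmul]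
  obtain ⟨c₀, -, hc₀⟩ := h.lead_g
  refine ⟨2 * r + 3, ⟨r + 1, by ring⟩, by omega, approx_of_eq_C_mul hc₀, δ, h.wdeg_g2, ?_⟩
  rw [hs, hs1, hs2, h.formDeg_g, h.wdeg_f3, h.formDeg_f23, h.formDeg_f13]
  refine ⟨?_, h.wdeg_f2.trans h.wdeg_g2.symm, fun φ hφ hφle => ?_, fun hlt => ?_, ?_, ?_, ?_, ?_,
    fun hne φ hφ hφle => h.exists_of_mem_f12 hw hFG hne hφ hφle, a, b, c, d, ψ, h.psi_mem,
    h.wdeg_psi, h.g1_eq, h.g2_eq, ?_, ?_, ?_, ?_, ?_, ?_, ?_, ?_, ?_⟩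
  · exact_mod_cast hle
  · obtain ⟨a', c', ψ', hψ', hψd, heq, -⟩ := h.exists_quadratic hw hFG hφ hφle
    exact ⟨a', c', ψ', hψ', hψd, heq⟩
  · obtain ⟨rfl, h3, ⟨c', -, hl⟩, a₁', ha₁', h5⟩ := h.of_wdeg_f1_lt hFG hlt
    refine ⟨rfl, approx_of_eq_C_mul hl, by exact_mod_cast h3, ?_⟩
    rw [ha₁']
    exact_mod_cast h5
  · -- If `deg f₁ < deg g₁`, the loss in `f₁` is compensated by `deg g₃ < δ + deg dg₁ ∧ dg₂`.
    obtain ⟨γ₃, hγ₃⟩ := exists_wdeg_eq w (hG.ne_zero 2)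
    have h5 := hFG.su5
    have h6 := hFG.su6
    rw [hγ₃, h.wdeg_f3] at h5
    rw [hγ₃, h.wdeg_g1, h.wdeg_g2, h.formDeg_g] at h6
    norm_cast at h5 h6
    simp only [tupleDeg, Fin.sum_univ_three, ha₁, hγ₃, h.wdeg_f2, h.wdeg_f3, h.wdeg_g1, h.wdeg_g2]
    norm_cast
    rcases hcase with h1 | ⟨-, rfl, h3, h7⟩
    · rw [h1]
      clear * - h5
      generalize r • δ = ρ at *
      grind
    · rw [zero_nsmul, nsmul_zero, zero_add] at h6 ⊢
      clear * - h3 h7 h6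
      grind
  · refine ⟨?_, ?_, fun i => ?_⟩
    · rw [h.wdeg_f2, ha₁]
      exact_mod_cast h2δ
    · rw [ha₁]
      exact_mod_cast h31
    · fin_cases i
      · change (δ : WithBot Γ) < wdeg w (F 0) ∧ wdeg w (F 0) ≤ _
        rw [ha₁]
        norm_cast
        refine ⟨?_, ha₁le⟩
        clear * - h2δ hδ
        grind
      · change (δ : WithBot Γ) < wdeg w (F 1) ∧ wdeg w (F 1) ≤ _
        rw [h.wdeg_f2]
        norm_cast
        clear * - hr hδ
        generalize r • δ = ρ at *
        constructor <;> grind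
      · change (δ : WithBot Γ) < wdeg w (F 2) ∧ wdeg w (F 2) ≤ _
        rw [h.wdeg_f3]
        norm_cast
        refine ⟨?_, hle'⟩
        clear * - hr hδ hle he
        generalize r • δ = ρ at *
        grind
  · refine ⟨fun i j hij hij' => ?_, fun hmem => ?_⟩
    · fin_cases i <;> fin_cases j <;> first
        | exact absurd rfl hij
        | exact absurd rfl hij'
        | exact h.lead_f1_notMem_f2 hFG
        | exact h.lead_f2_notMem_f1 hFG
        | exact h.lead_f2_notMem hFG
        | exact h.lead_f3_notMem_f1 hFG
        | exact h.lead_f3_notMem hFG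
    · obtain ⟨rfl, h3, c', hl⟩ := h.of_lead_f1_mem hFG hmem
      exact ⟨rfl, approx_of_eq_C_mul hl, by exact_mod_cast h3⟩
  · exact fun φ hφ hφle => h.exists_affine_of_mem_f13 hw hFG hφ hφle
  · rw [h.wdeg_f2, WithBot.coe_le_coe]
    rintro (ha | hb)
    · exact h.a₃_le_of_a_ne_zero ha
    · exact h.of_b_ne_zero hb
  · rw [h.wdeg_f2, WithBot.coe_le_coe]
    intro ha
    rw [h.r_eq_zero_of_a₃_le ha]
  · exact fun hψ G' hG' hQ' a' b' c' d' x' h1 h2 => h.coeff_unique hw hF hψ hG' hQ' h1 h2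
  · exact fun ha => h.formDeg_f12_of_a_ne_zero ha
  · exact fun ha hb => h.formDeg_f12_of_b_ne_zero ha hb
  · exact fun ha hb hc => h.formDeg_f12_of_c_ne_zero ha hb hc
  · exact fun ha hb hc => (h.formDeg_f12_of_eq_zero ha hb hc).trans h.formDeg_g
  · rfl
  · exact_mod_cast h.le_ε
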